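/- Let $\ell\ge 1$ and let $z_0,z_1,\dots,z_\ell\in\mathbb C$ be the successive vertices of a polygonal line in which consecutive segments $\overline{z_{p-1}z_p}$ and $\overline{z_pz_{p+1}}$ meet only at $z_p$ $(1\le p\le \ell-1)$. Let $0\le q\le \ell$ with $\operatorname{Im}\frac{z_q-z_0}{z_\ell-z_0}>0$, let $\Pi_0$ be the interior of the triangle with vertices $z_0,z_\ell,z_q$, and let $\Pi_1=\overline{\Pi_0}$. For $1\le j\le \ell$ let $S_j(w)=\frac{z_j-z_{j-1}}{z_\ell-z_0}(w-z_0)+z_{j-1}$ be the orientation preserving similitude with $S_j(z_0)=z_{j-1}$ and $S_j(z_\ell)=z_j$. The polygonal line is a *basic figure* if - $z_1,z_{\ell-1}\in\overline{z_0z_\ell}$ and $z_{\ell-1}\in\overline{z_1z_\ell}$; - every $z_j$ belongs to $\{z_q\}\cup\overline{z_0z_\ell}\cup\Pi_0$; - every $S_j$ is contractive, with ratio in $(0,1)$; - the sets $S_j(\Pi_0)$, $1\le j\le\ell$, are pairwise disjoint, and $S_j(z_q)\in\Pi_1$ for all $j$; - $S_j(\Pi_1)\cap(\overline{z_qz_0}\cup\overline{z_qz_\ell})=\emptyset$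 for $j\notin\{1,\ell,q,q+1\}$. With arguments taken in $[0,2\pi)$, its corner angles are $\theta_p=\arg\frac{S_p(z_q)-z_p}{S_{p+1}(z_q)-z_p}$ for $1\le p\le \ell-1$, with minimum $\theta_{\min}$, and its characteristic angle is $\xi=\theta_{\min}+\min(\eta_1,\eta_2)$, where $\eta_1=\arg\frac{S_q(z_q)-z_q}{z_0-z_q}$ and $\eta_2=\arg\frac{z_\ell-z_q}{S_{q+1}(z_q)-z_q}$. Let $\Lambda$ be the self-similar set of $S_1,\dots,S_\ell$, i.e. the unique non-empty compact set with $\Lambda=\bigcup_{j=1}^{\ell}S_j(\Lambda)$. If $\Lambda$ is an arc (a homeomorphic image of $[0,1]$) and $\xi>0$, then $\Lambda$ is called a *regular self-similar arc*. For $x,y\in\Lambda$ write $\Lambda(x,y)$ for the closed subarc between $x$ and $y$. **Theorem.** Let $\Lambda$ be a regular self-similar arc, generated as above by a basic figure with $\theta_{\min}>0$, and let $s=\dim_H\Lambda$. Then: 1. For every $t\ge 1$, $\Lambda$ is a $t$-quasi-arc: there is a constant $\lambda>0$ such that $(\operatorname{diam}\Lambda(x,y))^t\le\lambda|x-y|$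 for all $x,y\in\Lambda$. In particular $\Lambda$ is a quasi-arc (the case $t=1$). 2. $H^s(\Lambda)<\infty$, and the Hausdorff measure function $f(x)=H^s(\Lambda(z_0,x))$ is a strict Whitney function on $\Lambda$: there is a $C^1$ function $F:\mathbb R^2\to\mathbb R$ with $F|_\Lambda=f$ and $\nabla F=0$ on $\Lambda$, and $f$ is non-constant on $\Lambda$ and on each non-empty relatively open subset of $\Lambda$. -/

import Mathlib

open MeasureTheory

noncomputable section

/-! ### Arcs and quasi-arcs in the plane -/

/-- For an arc `E` parametrized by a homeomorphism `h : [0,1] → E` and points `x, y ∈ E`, the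
subarc of `E` lying between `x` and `y` (end points included). It does not depend on `h`. -/
def subarc {E : Set ℂ} (h : unitInterval ≃ₜ E) (x y : ℂ) : Set ℂ :=
  {w | ∃ a b c : unitInterval,
    (h a : ℂ) = x ∧ (h b : ℂ) = y ∧ c ∈ Set.uIcc a b ∧ (h c : ℂ) = w}

/-- `E` is a `t`-quasi-arc, `t ≥ 1`: it is an arc, and `|E(x,y)| ^ t ≤ lam * |x - y|` for all
`x, y ∈ E`, where `|E(x,y)|` is the diameter of the subarc between `x` and `y`. -/
def IsTQuasiArc (t : ℝ) (E : Set ℂ) : Prop :=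
  1 ≤ t ∧ ∃ h : unitInterval ≃ₜ E, ∃ lam : ℝ, 0 < lam ∧
    ∀ x ∈ E, ∀ y ∈ E, Metric.diam (subarc h x y) ^ t ≤ lam * dist x y

/-- A quasi-arc is a `1`-quasi-arc. -/
def IsQuasiArc (E : Set ℂ) : Prop := IsTQuasiArc 1 E

/-! ### Whitney functions -/

/-- `f` is a Whitney function on the connected set `E`: it is non-constant, and it is the
restriction to `E` of a `C¹` function on the plane whose gradient vanishes on `E`. -/
def IsWhitneyFunctionOn (E : Set ℂ) (f : E → ℝ) : Prop :=
  IsConnected E ∧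
  (∃ F : ℂ → ℝ, ContDiff ℝ 1 F ∧ (∀ x ∈ E, fderiv ℝ F x = 0) ∧ ∀ x : E, F x = f x) ∧
  ∃ x y : E, f x ≠ f y

/-- A strict Whitney function on `E` is a Whitney function on `E` that is non-constant on each
non-empty relatively open subset of `E`. -/
def IsStrictWhitneyFunctionOn (E : Set ℂ) (f : E → ℝ) : Prop :=
  IsWhitneyFunctionOn E f ∧
  ∀ U : Set E, IsOpen U → U.Nonempty → ∃ x ∈ U, ∃ y ∈ U, f x ≠ f y

/-! ### Basic figures -/

/-- The orientation preserving similitude `S_j` (for `1 ≤ j ≤ ℓ`) of the plane with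
`S_j (z 0) = z (j - 1)` and `S_j (z ℓ) = z j`. -/
def figureMap (ℓ : ℕ) (z : ℕ → ℂ) (j : ℕ) (w : ℂ) : ℂ :=
  (z j - z (j - 1)) / (z ℓ - z 0) * (w - z 0) + z (j - 1)

/-- The interior `Π₀` of the triangle with vertices `z 0`, `z ℓ`, `z q`. -/
def openTriangle (ℓ q : ℕ) (z : ℕ → ℂ) : Set ℂ :=
  interior (convexHull ℝ {z 0, z ℓ, z q})

/-- The closure `Π₁` of `Π₀`. -/
def closedTriangle (ℓ q : ℕ) (z : ℕ → ℂ) : Set ℂ :=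
  closure (openTriangle ℓ q z)

/-- The polygon with successive vertices `z 0, …, z ℓ` is a basic figure whose basic triangle has
the vertices `z 0`, `z ℓ`, `z q`. Only the values `z 0, …, z ℓ` matter. -/
structure IsBasicFigure (ℓ q : ℕ) (z : ℕ → ℂ) : Prop where
  q_le : q ≤ ℓ
  /-- The triangle is non-degenerate, and `z q` lies to the left of the line from `z 0` to
  `z ℓ`. -/
  orientation : 0 < ((z q - z 0) / (z ℓ - z 0)).im
  /-- Successive segments of the polygon meet only at their common end point. -/
  polygon : ∀ p, 1 ≤ p → p < ℓ →
    segment ℝ (z (p - 1)) (z p) ∩ segment ℝ (z p) (z (p + 1)) = {z p}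
  first_mem : z 1 ∈ segment ℝ (z 0) (z ℓ)
  last_mem : z (ℓ - 1) ∈ segment ℝ (z 0) (z ℓ)
  last_mem' : z (ℓ - 1) ∈ segment ℝ (z 1) (z ℓ)
  vertex_mem : ∀ j ≤ ℓ, z j ∈ {z q} ∪ segment ℝ (z 0) (z ℓ) ∪ openTriangle ℓ q z
  /-- The similitudes `S_j` are contractive, with ratios in `(0, 1)`. -/
  contractive : ∀ j, 1 ≤ j → j ≤ ℓ →
    0 < ‖(z j - z (j - 1)) / (z ℓ - z 0)‖ ∧ ‖(z j - z (j - 1)) / (z ℓ - z 0)‖ < 1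
  disjoint : ∀ i j, 1 ≤ i → i ≤ ℓ → 1 ≤ j → j ≤ ℓ → i ≠ j →
    Disjoint (figureMap ℓ z i '' openTriangle ℓ q z) (figureMap ℓ z j '' openTriangle ℓ q z)
  apex_mem : ∀ j, 1 ≤ j → j ≤ ℓ → figureMap ℓ z j (z q) ∈ closedTriangle ℓ q z
  sides : ∀ j, 1 ≤ j → j ≤ ℓ → j ≠ 1 → j ≠ ℓ → j ≠ q → j ≠ q + 1 →
    figureMap ℓ z j '' closedTriangle ℓ q z ∩
      (segment ℝ (z q) (z 0) ∪ segment ℝ (z q) (z ℓ)) = ∅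

/-- The argument of `w`, taken in `[0, 2π)`. -/
def posArg (w : ℂ) : ℝ := toIcoMod Real.two_pi_pos 0 w.arg

/-- The corner angle `θ_p` at the vertex `z p`, for `1 ≤ p ≤ ℓ - 1`. -/
def cornerAngle (ℓ q : ℕ) (z : ℕ → ℂ) (p : ℕ) : ℝ :=
  posArg ((figureMap ℓ z p (z q) - z p) / (figureMap ℓ z (p + 1) (z q) - z p))

/-- The minimal corner angle `θ_min = min {θ_1, …, θ_{ℓ-1}}`. -/
def minCornerAngle (ℓ q : ℕ) (z : ℕ → ℂ) : ℝ :=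
  sInf (cornerAngle ℓ q z '' Set.Icc 1 (ℓ - 1))

/-- The characteristic angle `ξ = θ_min + min (η_1, η_2)`. -/
def characteristicAngle (ℓ q : ℕ) (z : ℕ → ℂ) : ℝ :=
  minCornerAngle ℓ q z +
    min (posArg ((figureMap ℓ z q (z q) - z q) / (z 0 - z q)))
      (posArg ((z ℓ - z q) / (figureMap ℓ z (q + 1) (z q) - z q)))

/-! ### Regular self-similar arcs -/

/-- `Λ` is the regular self-similar arc generated by the basic figure with vertices
`z 0, …, z ℓ` and apex `z q`. -/
structure IsRegularSelfSimilarArc (ℓ q : ℕ) (z : ℕ → ℂ) (Λ : Set ℂ) : Prop where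
  basicFigure : IsBasicFigure ℓ q z
  /-- `Λ` is the self-similar set of the similitudes `S_1, …, S_ℓ`. -/
  nonempty : Λ.Nonempty
  isCompact : IsCompact Λ
  selfSimilar : Λ = ⋃ j ∈ Set.Icc 1 ℓ, figureMap ℓ z j '' Λ
  /-- `Λ` is an arc. -/
  isArc : Nonempty (unitInterval ≃ₜ Λ)
  characteristicAngle_pos : 0 < characteristicAngle ℓ q z

/-- The `s`-dimensional Hausdorff measure function `x ↦ H^s([x₀, x])` on an arc `E`. -/
def hausdorffMeasureFunction {E : Set ℂ} (h : unitInterval ≃ₜ E) (s : ℝ) (x₀ : ℂ) (x : E) : ℝ :=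
  (μH[s] (subarc h x₀ x)).toReal

end

/-!
Let `r j` be the ratios of the similitudes and choose `s` with `∑ r j ^ s = 1`; since the polygon
is longer than its base, `s > 1`. Subdividing `[0, 1]` self-similarly into cells of lengths
`r j ^ s` gives a parametrization `γ` of `Λ` for which `|a - b|` and `dist (γ a) (γ b) ^ s` are both
multiplied by `r j ^ s` when `a`, `b` are moved into the `j`-th cell. By scaling, these two
quantities are comparable as soon as they are comparable for `a`, `b` in different cells.
Non-adjacent pieces of `Λ` are disjoint compact sets, because the pieces form a chain of subarcs
of an arc; adjacent pieces lie in two cones at their common vertex, which meet only at the vertex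
because the corner angle is positive. Hence `c * |a - b| ≤ dist (γ a) (γ b) ^ s ≤ C * |a - b|`.
Both claims follow: the diameter of a subarc is comparable to the distance of its end points, and
`H ^ s` is comparable to the length of the parameter interval. The Hausdorff measure function is
therefore Hölder of exponent `s > 1`, so it extends to a `C¹` function whose gradient vanishes on
`Λ`.
-/

noncomputable section

open Set Filter Topology
open scoped Convolution

/-! ### Subdivisions of the unit interval -/

/-- The `k`-th node of the subdivision with cell lengths `w 0, w 1, …`. -/
def meshNode (w : ℕ → ℝ) (k : ℕ) : ℝ := ∑ i ∈ Finset.range k, w i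

/-- The affine map of `[0, 1]` onto the `j`-th cell of the subdivision. -/
def cellMap (w : ℕ → ℝ) (j : ℕ) (u : ℝ) : ℝ := meshNode w j + w j * u

lemma meshNode_zero (w : ℕ → ℝ) : meshNode w 0 = 0 := Finset.sum_range_zero _

lemma meshNode_succ (w : ℕ → ℝ) (k : ℕ) : meshNode w (k + 1) = meshNode w k + w k :=
  Finset.sum_range_succ _ _

lemma cellMap_zero (w : ℕ → ℝ) (j : ℕ) : cellMap w j 0 = meshNode w j := by simp [cellMap]

lemma cellMap_one (w : ℕ → ℝ) (j : ℕ) : cellMap w j 1 = meshNode w (j + 1) := by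
  simp [cellMap, meshNode_succ]

lemma cellMap_sub (w : ℕ → ℝ) (j : ℕ) (u v : ℝ) :
    cellMap w j u - cellMap w j v = w j * (u - v) := by
  simp only [cellMap]; ring

lemma exists_lt_forall_le_of_forall_lt {n : ℕ} {r : ℕ → ℝ} {c : ℝ} (hr : ∀ j < n, r j < c) :
    ∃ ρ < c, ∀ j < n, r j ≤ ρ := by
  induction n with
  | zero => exact ⟨c - 1, by linarith, fun j hj => absurd hj j.not_lt_zero⟩
  | succ n ih =>
    obtain ⟨ρ, hρ, h⟩ := ih fun j hj => hr j (hj.trans n.lt_succ_self)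
    refine ⟨max ρ (r n), max_lt hρ (hr n n.lt_succ_self), fun j hj => ?_⟩
    rcases Nat.lt_succ_iff_lt_or_eq.1 hj with hj | rfl
    · exact (h j hj).trans (le_max_left _ _)
    · exact le_max_right _ _

/-- A partition of `[0, 1]` into `n` cells, recorded by their lengths `w 0, …, w (n - 1)`. -/
structure IsUnitMesh (n : ℕ) (w : ℕ → ℝ) : Prop where
  pos : ∀ j < n, 0 < w j
  sum_eq : ∑ i ∈ Finset.range n, w i = 1

namespace IsUnitMesh

variable {n : ℕ} {w : ℕ → ℝ}

lemma meshNode_last (hw : IsUnitMesh n w) : meshNode w n = 1 := hw.sum_eq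

lemma card_pos (hw : IsUnitMesh n w) : 0 < n := by
  rw [Nat.pos_iff_ne_zero]
  rintro rfl
  exact zero_ne_one hw.sum_eq

lemma meshNode_le (hw : IsUnitMesh n w) {i j : ℕ} (hij : i ≤ j) (hj : j ≤ n) :
    meshNode w i ≤ meshNode w j :=
  Finset.sum_le_sum_of_subset_of_nonneg (Finset.range_subset_range.2 hij) fun k hk _ =>
    (hw.pos k ((Finset.mem_range.1 hk).trans_le hj)).le

lemma exists_pos_forall_le (hw : IsUnitMesh n w) : ∃ η > 0, ∀ j < n, η ≤ w j := by
  obtain ⟨ρ, hρ, h⟩ := exists_lt_forall_le_of_forall_lt (r := fun j => -w j) (c := 0)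
    fun j hj => neg_neg_of_pos (hw.pos j hj)
  exact ⟨-ρ, neg_pos.2 hρ, fun j hj => neg_le.1 (h j hj)⟩

lemma cellMap_mem_Icc_meshNode (hw : IsUnitMesh n w) {j : ℕ} (hj : j < n) {u : ℝ}
    (hu : u ∈ Icc (0 : ℝ) 1) : cellMap w j u ∈ Icc (meshNode w j) (meshNode w (j + 1)) := by
  have hpos := hw.pos j hj
  rw [meshNode_succ, cellMap]
  exact ⟨le_add_of_nonneg_right (mul_nonneg hpos.le hu.1),
    add_le_add_right (mul_le_of_le_one_right hpos.le hu.2) _⟩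

lemma cellMap_mem (hw : IsUnitMesh n w) {j : ℕ} (hj : j < n) {u : ℝ}
    (hu : u ∈ Icc (0 : ℝ) 1) : cellMap w j u ∈ Icc (0 : ℝ) 1 := by
  have h0 := hw.meshNode_le (Nat.zero_le j) hj.le
  have h1 := hw.meshNode_le (Nat.succ_le_of_lt hj) le_rfl
  rw [meshNode_zero] at h0
  rw [hw.meshNode_last] at h1
  exact Icc_subset_Icc h0 h1 (hw.cellMap_mem_Icc_meshNode hj hu)

lemma exists_cellMap_eq (hw : IsUnitMesh n w) {t : ℝ} (ht : t ∈ Icc (0 : ℝ) 1) :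
    ∃ j < n, ∃ u ∈ Icc (0 : ℝ) 1, cellMap w j u = t := by
  have hex : ∃ k < n, t ≤ meshNode w (k + 1) :=
    ⟨n - 1, Nat.sub_one_lt_of_lt hw.card_pos,
      by rw [Nat.sub_add_cancel hw.card_pos, hw.meshNode_last]; exact ht.2⟩
  classical
  obtain ⟨hk, hle⟩ := Nat.find_spec hex
  set k := Nat.find hex with hkdef
  have hge : meshNode w k ≤ t := by
    rcases Nat.eq_zero_or_pos k with h0 | hpos
    · rw [h0, meshNode_zero]; exact ht.1
    · by_contra! hlt
      have hmin := Nat.find_min hex (Nat.sub_one_lt_of_lt (hkdef ▸ hpos))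
      rw [← hkdef, Nat.sub_add_cancel hpos] at hmin
      exact hmin ⟨by omega, hlt.le⟩
  have hpos := hw.pos k hk
  rw [meshNode_succ] at hle
  refine ⟨k, hk, (t - meshNode w k) / w k, ⟨div_nonneg (by linarith) hpos.le, ?_⟩, ?_⟩
  · rw [div_le_one hpos]; linarith
  · rw [cellMap, mul_div_cancel₀ _ hpos.ne']; ring

lemma eq_of_cellMap_eq (hw : IsUnitMesh n w) {i j : ℕ} (hij : i < j) (hj : j < n) {u v : ℝ}
    (hu : u ∈ Icc (0 : ℝ) 1) (hv : v ∈ Icc (0 : ℝ) 1) (h : cellMap w i u = cellMap w j v) :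
    j = i + 1 ∧ u = 1 ∧ v = 0 := by
  have hi := hw.pos i (hij.trans hj)
  have hpj := hw.pos j hj
  have hnodes := hw.meshNode_le (Nat.succ_le_of_lt hij) hj.le
  rw [Nat.succ_eq_add_one, meshNode_succ] at hnodes
  simp only [cellMap] at h
  obtain rfl : u = 1 := by nlinarith [hu.2, hv.1]
  obtain rfl : v = 0 := by nlinarith [hv.1]
  refine ⟨?_, rfl, rfl⟩
  by_contra hne
  have hlt : i + 1 < j := by omega
  have hnodes' := hw.meshNode_le (Nat.succ_le_of_lt hlt) hj.le
  rw [Nat.succ_eq_add_one, meshNode_succ, meshNode_succ] at hnodes'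
  linarith [hw.pos (i + 1) (hlt.trans hj)]

lemma eq_of_cellMap_eq_zero (hw : IsUnitMesh n w) {j : ℕ} (hj : j < n) {u : ℝ}
    (hu : u ∈ Icc (0 : ℝ) 1) (h : cellMap w j u = 0) : j = 0 ∧ u = 0 := by
  rcases Nat.eq_zero_or_pos j with rfl | hpos
  · rw [cellMap, meshNode_zero, zero_add] at h
    exact ⟨rfl, (mul_eq_zero.1 h).resolve_left (hw.pos 0 hj).ne'⟩
  · have h0 : cellMap w 0 0 = cellMap w j u := by rw [h, cellMap_zero, meshNode_zero]
    exact absurd (hw.eq_of_cellMap_eq hpos hj ⟨le_rfl, zero_le_one⟩ hu h0).2.1 zero_ne_one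

lemma eq_of_cellMap_eq_one (hw : IsUnitMesh n w) {j : ℕ} (hj : j < n) {u : ℝ}
    (hu : u ∈ Icc (0 : ℝ) 1) (h : cellMap w j u = 1) : j + 1 = n ∧ u = 1 := by
  have hlast : cellMap w (n - 1) 1 = 1 := by
    rw [cellMap_one, Nat.sub_add_cancel hw.card_pos, hw.meshNode_last]
  rcases (Nat.le_sub_one_of_lt hj).lt_or_eq with hlt | rfl
  · exact absurd (hw.eq_of_cellMap_eq hlt (by omega) hu ⟨zero_le_one, le_rfl⟩
      (h.trans hlast.symm)).2.2 one_ne_zero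
  · refine ⟨Nat.sub_add_cancel hw.card_pos, ?_⟩
    have hsub := cellMap_sub w (n - 1) u 1
    rw [h, hlast, sub_self] at hsub
    exact sub_eq_zero.1 ((mul_eq_zero.1 hsub.symm).resolve_left (hw.pos _ hj).ne')

lemma weight_lt_one (hw : IsUnitMesh n w) (hn : 1 < n) {j : ℕ} (hj : j < n) : w j < 1 := by
  obtain ⟨k, hk, hkj⟩ : ∃ k < n, k ≠ j := by
    rcases eq_or_ne j 0 with rfl | h
    · exact ⟨1, hn, one_ne_zero⟩
    · exact ⟨0, by omega, h.symm⟩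
  rw [← hw.sum_eq]
  exact Finset.single_lt_sum hkj (Finset.mem_range.2 hj) (Finset.mem_range.2 hk) (hw.pos k hk)
    fun i hi _ => (hw.pos i (Finset.mem_range.1 hi)).le

lemma pair_induction (hw : IsUnitMesh n w) (hn : 1 < n) {Q : ℝ → ℝ → Prop}
    (hdiag : ∀ a ∈ Icc (0 : ℝ) 1, Q a a)
    (hcell : ∀ j < n, ∀ a ∈ Icc (0 : ℝ) 1, ∀ b ∈ Icc (0 : ℝ) 1, Q a b →
      Q (cellMap w j a) (cellMap w j b))
    (hdiff : ∀ i j, i < j → j < n → ∀ a ∈ Icc (0 : ℝ) 1, ∀ b ∈ Icc (0 : ℝ) 1,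
      Q (cellMap w i a) (cellMap w j b)) {a b : ℝ}
    (ha : a ∈ Icc (0 : ℝ) 1) (hb : b ∈ Icc (0 : ℝ) 1) (hab : a ≤ b) : Q a b := by
  obtain ⟨ρ, hρ1, hρ⟩ := exists_lt_forall_le_of_forall_lt fun j => hw.weight_lt_one hn (j := j)
  have hρ0 : 0 < ρ := (hw.pos 0 hw.card_pos).trans_le (hρ 0 hw.card_pos)
  -- Undoing a cell map enlarges the gap `b - a` by a factor at least `ρ⁻¹`.
  have key : ∀ k : ℕ, ∀ a ∈ Icc (0 : ℝ) 1, ∀ b ∈ Icc (0 : ℝ) 1, ρ ^ k < b - a → Q a b := by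
    intro k
    induction k with
    | zero =>
      intro a ha b hb hgap
      linarith [ha.1, hb.2, pow_zero ρ]
    | succ k ih =>
      intro a ha b hb hgap
      have hlt : a < b := sub_pos.1 ((pow_pos hρ0 _).trans hgap)
      obtain ⟨i, hi, u, hu, rfl⟩ := hw.exists_cellMap_eq ha
      obtain ⟨j, hj, v, hv, rfl⟩ := hw.exists_cellMap_eq hb
      rcases lt_trichotomy i j with hij | rfl | hij
      · exact hdiff i j hij hj u hu v hv
      · rw [cellMap_sub, pow_succ'] at hgap
        have huv : 0 < v - u := by
          rw [← sub_pos, cellMap_sub] at hlt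
          exact pos_of_mul_pos_right hlt (hw.pos i hi).le
        exact hcell i hi u hu v hv (ih u hu v hv (lt_of_mul_lt_mul_left
          (hgap.trans_le (mul_le_mul_of_nonneg_right (hρ i hi) huv.le)) hρ0.le))
      · have hnode := hw.meshNode_le (Nat.succ_le_of_lt hij) hi.le
        exact absurd hlt (not_lt.2 ((hw.cellMap_mem_Icc_meshNode hj hv).2.trans
          (hnode.trans (hw.cellMap_mem_Icc_meshNode hi hu).1)))
  rcases hab.eq_or_lt with rfl | hlt
  · exact hdiag a ha
  · obtain ⟨k, hk⟩ := exists_pow_lt_of_lt_one (sub_pos.2 hlt) hρ1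
    exact key k a ha b hb hk

lemma zero_induction (hw : IsUnitMesh n w) (hn : 1 < n) {P : ℝ → Prop} (h0 : P 0)
    (hcell : ∀ b ∈ Icc (0 : ℝ) 1, P b → P (cellMap w 0 b))
    (hlater : ∀ j, 0 < j → j < n → ∀ b ∈ Icc (0 : ℝ) 1, P (cellMap w j b)) {b : ℝ}
    (hb : b ∈ Icc (0 : ℝ) 1) : P b := by
  refine hw.pair_induction hn (Q := fun a b => a = 0 → P b) (fun a _ h => h ▸ h0) ?_
    (fun i j hij hj _ _ v hv _ => hlater j (by omega) hj v hv) ⟨le_rfl, zero_le_one⟩ hb hb.1 rfl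
  intro j hj u hu v hv ih he
  obtain ⟨rfl, rfl⟩ := hw.eq_of_cellMap_eq_zero hj hu he
  exact hcell v hv (ih rfl)

lemma one_induction (hw : IsUnitMesh n w) (hn : 1 < n) {P : ℝ → Prop} (h1 : P 1)
    (hcell : ∀ a ∈ Icc (0 : ℝ) 1, P a → P (cellMap w (n - 1) a))
    (hearlier : ∀ i, i + 1 < n → ∀ a ∈ Icc (0 : ℝ) 1, P (cellMap w i a)) {a : ℝ}
    (ha : a ∈ Icc (0 : ℝ) 1) : P a := by
  refine hw.pair_induction hn (Q := fun a b => b = 1 → P a) (fun b _ h => h ▸ h1) ?_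
    (fun i j hij hj u hu _ _ _ => hearlier i (by omega) u hu) ha ⟨zero_le_one, le_rfl⟩ ha.2 rfl
  intro j hj u hu v hv ih he
  obtain ⟨rfl, rfl⟩ := hw.eq_of_cellMap_eq_one hj hv he
  exact hcell u hu (ih rfl)

end IsUnitMesh

/-! ### Comparison of cell-homogeneous functions -/

/-- `f a b`, thought of as a gauge of the interval `[a, b]`, scales like length under the cell
maps. -/
def IsCellHomogeneous (n : ℕ) (w : ℕ → ℝ) (f : ℝ → ℝ → ℝ) : Prop :=
  ∀ j < n, ∀ a ∈ Icc (0 : ℝ) 1, ∀ b ∈ Icc (0 : ℝ) 1,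
    f (cellMap w j a) (cellMap w j b) = w j * f a b

/-- A bounded cell-homogeneous gauge that satisfies the triangle inequality up to a constant. -/
structure IsCellQuasiMetric (n : ℕ) (w : ℕ → ℝ) (f : ℝ → ℝ → ℝ) : Prop where
  homogeneous : IsCellHomogeneous n w f
  self : ∀ a ∈ Icc (0 : ℝ) 1, f a a = 0
  bounded : ∃ D > 0, ∀ a ∈ Icc (0 : ℝ) 1, ∀ b ∈ Icc (0 : ℝ) 1, f a b ≤ D
  triangle : ∃ A ≥ 0, ∀ a b c, f a b ≤ A * (f a c + f c b)

/-- The gauge `g` sees the cells of the subdivision apart: it is bounded below across non-adjacent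
cells, and across the common node of two adjacent cells it dominates the gauges of both parts. -/
structure IsCellSeparated (n : ℕ) (w : ℕ → ℝ) (g : ℝ → ℝ → ℝ) : Prop where
  homogeneous : IsCellHomogeneous n w g
  nonneg : ∀ a ∈ Icc (0 : ℝ) 1, ∀ b ∈ Icc (0 : ℝ) 1, 0 ≤ g a b
  zero_one_pos : 0 < g 0 1
  nonadjacent : ∃ η > 0, ∀ i j, i + 1 < j → j < n → ∀ a ∈ Icc (0 : ℝ) 1, ∀ b ∈ Icc (0 : ℝ) 1,
    η ≤ g (cellMap w i a) (cellMap w j b)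
  adjacent : ∃ B > 0, ∀ i, i + 1 < n → ∀ a ∈ Icc (0 : ℝ) 1, ∀ b ∈ Icc (0 : ℝ) 1,
    g (cellMap w i a) (cellMap w i 1) ≤ B * g (cellMap w i a) (cellMap w (i + 1) b) ∧
    g (cellMap w (i + 1) 0) (cellMap w (i + 1) b) ≤ B * g (cellMap w i a) (cellMap w (i + 1) b)

namespace IsCellSeparated

variable {n : ℕ} {w : ℕ → ℝ} {f g : ℝ → ℝ → ℝ}

lemma exists_le_zero_left (hg : IsCellSeparated n w g) (hw : IsUnitMesh n w) :
    ∃ c > 0, ∀ j, 0 < j → j < n → ∀ b ∈ Icc (0 : ℝ) 1, c ≤ g 0 (cellMap w j b) := by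
  obtain ⟨η, hη, hfar⟩ := hg.nonadjacent
  obtain ⟨B, hB, hadj⟩ := hg.adjacent
  have h0 : (0 : ℝ) ∈ Icc (0 : ℝ) 1 := ⟨le_rfl, zero_le_one⟩
  have hw0 := hw.pos 0 hw.card_pos
  have hzero : cellMap w 0 0 = 0 := by rw [cellMap_zero, meshNode_zero]
  refine ⟨min η (w 0 * g 0 1 / B), lt_min hη (div_pos (mul_pos hw0 hg.zero_one_pos) hB),
    fun j hj0 hj b hb => ?_⟩
  rcases (Nat.succ_le_of_lt hj0).eq_or_lt with rfl | hlt
  · refine (min_le_right _ _).trans ((div_le_iff₀' hB).2 ?_)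
    have hnear := (hadj 0 hj 0 h0 b hb).1
    rwa [hg.homogeneous 0 hw.card_pos 0 h0 1 ⟨zero_le_one, le_rfl⟩, hzero] at hnear
  · exact (min_le_left _ _).trans (hzero ▸ hfar 0 j hlt hj 0 h0 b hb)

lemma exists_le_one_right (hg : IsCellSeparated n w g) (hw : IsUnitMesh n w) :
    ∃ c > 0, ∀ i, i + 1 < n → ∀ a ∈ Icc (0 : ℝ) 1, c ≤ g (cellMap w i a) 1 := by
  obtain ⟨η, hη, hfar⟩ := hg.nonadjacent
  obtain ⟨B, hB, hadj⟩ := hg.adjacent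
  have h1 : (1 : ℝ) ∈ Icc (0 : ℝ) 1 := ⟨zero_le_one, le_rfl⟩
  have hlast : n - 1 < n := Nat.sub_one_lt_of_lt hw.card_pos
  have hone : cellMap w (n - 1) 1 = 1 := by
    rw [cellMap_one, Nat.sub_add_cancel hw.card_pos, hw.meshNode_last]
  refine ⟨min η (w (n - 1) * g 0 1 / B),
    lt_min hη (div_pos (mul_pos (hw.pos _ hlast) hg.zero_one_pos) hB), fun i hi a ha => ?_⟩
  rcases (Nat.le_sub_one_of_lt hi).eq_or_lt with he | hlt
  · refine (min_le_right _ _).trans ((div_le_iff₀' hB).2 ?_)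
    have hnear := (hadj i hi a ha 1 h1).2
    rwa [hg.homogeneous (i + 1) hi 0 ⟨le_rfl, zero_le_one⟩ 1 h1, he, hone] at hnear
  · exact (min_le_left _ _).trans (hone ▸ hfar i (n - 1) hlt hlast a ha 1 h1)

lemma exists_le_mul_of_zero_left (hg : IsCellSeparated n w g) (hw : IsUnitMesh n w) (hn : 1 < n)
    (hf : IsCellQuasiMetric n w f) :
    ∃ C > 0, ∀ b ∈ Icc (0 : ℝ) 1, f 0 b ≤ C * g 0 b := by
  obtain ⟨c, hc, hsep⟩ := hg.exists_le_zero_left hw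
  obtain ⟨D, hD, hfD⟩ := hf.bounded
  have h0 : (0 : ℝ) ∈ Icc (0 : ℝ) 1 := ⟨le_rfl, zero_le_one⟩
  have hC : 0 < D / c := div_pos hD hc
  refine ⟨D / c, hC, fun b hb =>
    hw.zero_induction hn (P := fun b => f 0 b ≤ D / c * g 0 b) ?_ (fun b hb ih => ?_) ?_ hb⟩
  · rw [hf.self 0 h0]
    exact mul_nonneg hC.le (hg.nonneg 0 h0 0 h0)
  · have hzero : cellMap w 0 0 = 0 := by rw [cellMap_zero, meshNode_zero]
    rw [← hzero, hf.homogeneous 0 hw.card_pos 0 h0 b hb, hg.homogeneous 0 hw.card_pos 0 h0 b hb,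
      mul_left_comm]
    exact mul_le_mul_of_nonneg_left ih (hw.pos 0 hw.card_pos).le
  · intro j hj0 hj b hb
    calc f 0 (cellMap w j b) ≤ D := hfD 0 h0 _ (hw.cellMap_mem hj hb)
      _ = D / c * c := (div_mul_cancel₀ D hc.ne').symm
      _ ≤ D / c * g 0 (cellMap w j b) := mul_le_mul_of_nonneg_left (hsep j hj0 hj b hb) hC.le

lemma exists_le_mul_of_one_right (hg : IsCellSeparated n w g) (hw : IsUnitMesh n w) (hn : 1 < n)
    (hf : IsCellQuasiMetric n w f) :
    ∃ C > 0, ∀ a ∈ Icc (0 : ℝ) 1, f a 1 ≤ C * g a 1 := by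
  obtain ⟨c, hc, hsep⟩ := hg.exists_le_one_right hw
  obtain ⟨D, hD, hfD⟩ := hf.bounded
  have h1 : (1 : ℝ) ∈ Icc (0 : ℝ) 1 := ⟨zero_le_one, le_rfl⟩
  have hC : 0 < D / c := div_pos hD hc
  refine ⟨D / c, hC, fun a ha =>
    hw.one_induction hn (P := fun a => f a 1 ≤ D / c * g a 1) ?_ (fun a ha ih => ?_) ?_ ha⟩
  · rw [hf.self 1 h1]
    exact mul_nonneg hC.le (hg.nonneg 1 h1 1 h1)
  · have hlast : n - 1 < n := Nat.sub_one_lt_of_lt hw.card_pos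
    have hone : cellMap w (n - 1) 1 = 1 := by
      rw [cellMap_one, Nat.sub_add_cancel hw.card_pos, hw.meshNode_last]
    rw [← hone, hf.homogeneous _ hlast a ha 1 h1, hg.homogeneous _ hlast a ha 1 h1, mul_left_comm]
    exact mul_le_mul_of_nonneg_left ih (hw.pos _ hlast).le
  · intro i hi a ha
    calc f (cellMap w i a) 1 ≤ D := hfD _ (hw.cellMap_mem (by omega) ha) 1 h1
      _ = D / c * c := (div_mul_cancel₀ D hc.ne').symm
      _ ≤ D / c * g (cellMap w i a) 1 := mul_le_mul_of_nonneg_left (hsep i hi a ha) hC.le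

lemma exists_adjacent_le_mul (hg : IsCellSeparated n w g) (hw : IsUnitMesh n w) (hn : 1 < n)
    (hf : IsCellQuasiMetric n w f) :
    ∃ C > 0, ∀ i, i + 1 < n → ∀ a ∈ Icc (0 : ℝ) 1, ∀ b ∈ Icc (0 : ℝ) 1,
      f (cellMap w i a) (cellMap w (i + 1) b) ≤
        C * g (cellMap w i a) (cellMap w (i + 1) b) := by
  obtain ⟨C₀, hC₀, hleft⟩ := hg.exists_le_mul_of_zero_left hw hn hf
  obtain ⟨C₁, hC₁, hright⟩ := hg.exists_le_mul_of_one_right hw hn hf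
  obtain ⟨A, hA, htri⟩ := hf.triangle
  obtain ⟨B, hB, hadj⟩ := hg.adjacent
  have h0 : (0 : ℝ) ∈ Icc (0 : ℝ) 1 := ⟨le_rfl, zero_le_one⟩
  have h1 : (1 : ℝ) ∈ Icc (0 : ℝ) 1 := ⟨zero_le_one, le_rfl⟩
  refine ⟨A * ((C₁ + C₀) * B) + 1, by positivity, fun i hi a ha b hb => ?_⟩
  have hi' : i < n := by omega
  have hnode : cellMap w i 1 = cellMap w (i + 1) 0 := by rw [cellMap_one, cellMap_zero]
  obtain ⟨hga, hgb⟩ := hadj i hi a ha b hb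
  have hfa : f (cellMap w i a) (cellMap w i 1) ≤
      C₁ * (B * g (cellMap w i a) (cellMap w (i + 1) b)) := by
    refine le_trans ?_ (mul_le_mul_of_nonneg_left hga hC₁.le)
    rw [hf.homogeneous i hi' a ha 1 h1, hg.homogeneous i hi' a ha 1 h1, mul_left_comm]
    exact mul_le_mul_of_nonneg_left (hright a ha) (hw.pos i hi').le
  have hfb : f (cellMap w (i + 1) 0) (cellMap w (i + 1) b) ≤
      C₀ * (B * g (cellMap w i a) (cellMap w (i + 1) b)) := by
    refine le_trans ?_ (mul_le_mul_of_nonneg_left hgb hC₀.le)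
    rw [hf.homogeneous _ hi 0 h0 b hb, hg.homogeneous _ hi 0 h0 b hb, mul_left_comm]
    exact mul_le_mul_of_nonneg_left (hleft b hb) (hw.pos _ hi).le
  have hgap := hg.nonneg _ (hw.cellMap_mem hi' ha) _ (hw.cellMap_mem hi hb)
  calc f (cellMap w i a) (cellMap w (i + 1) b)
      ≤ A * (f (cellMap w i a) (cellMap w i 1) + f (cellMap w i 1) (cellMap w (i + 1) b)) :=
        htri _ _ _
    _ ≤ A * (C₁ * (B * g (cellMap w i a) (cellMap w (i + 1) b)) +
          C₀ * (B * g (cellMap w i a) (cellMap w (i + 1) b))) := by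
        rw [hnode] at hfa ⊢; gcongr
    _ ≤ _ := by linarith

/-- A bounded quasi-metric gauge is dominated by every gauge that sees the cells apart: by scaling
it suffices to compare them on pairs of points in different cells. -/
theorem exists_le_mul (hg : IsCellSeparated n w g) (hw : IsUnitMesh n w) (hn : 1 < n)
    (hf : IsCellQuasiMetric n w f) :
    ∃ C > 0, ∀ a ∈ Icc (0 : ℝ) 1, ∀ b ∈ Icc (0 : ℝ) 1, a ≤ b → f a b ≤ C * g a b := by
  obtain ⟨C, hC, hnear⟩ := hg.exists_adjacent_le_mul hw hn hf
  obtain ⟨D, -, hfD⟩ := hf.bounded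
  obtain ⟨η, hη, hfar⟩ := hg.nonadjacent
  have hmax : 0 < max C (D / η) := lt_max_of_lt_left hC
  refine ⟨max C (D / η), hmax, fun a ha b hb hab =>
    hw.pair_induction hn (Q := fun a b => f a b ≤ max C (D / η) * g a b) ?_ ?_ ?_ ha hb hab⟩
  · intro a ha
    rw [hf.self a ha]
    exact mul_nonneg hmax.le (hg.nonneg a ha a ha)
  · intro j hj a ha b hb ih
    rw [hf.homogeneous j hj a ha b hb, hg.homogeneous j hj a ha b hb, mul_left_comm]
    exact mul_le_mul_of_nonneg_left ih (hw.pos j hj).le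
  · intro i j hij hj a ha b hb
    have ha' := hw.cellMap_mem (hij.trans hj) ha
    have hb' := hw.cellMap_mem hj hb
    rcases (Nat.succ_le_of_lt hij).eq_or_lt with rfl | hlt
    · exact (hnear i hj a ha b hb).trans
        (mul_le_mul_of_nonneg_right (le_max_left _ _) (hg.nonneg _ ha' _ hb'))
    · calc f (cellMap w i a) (cellMap w j b) ≤ D := hfD _ ha' _ hb'
        _ = D / η * η := (div_mul_cancel₀ D hη.ne').symm
        _ ≤ _ := mul_le_mul (le_max_right _ _) (hfar i j hlt hj a ha b hb) hη.le hmax.le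

end IsCellSeparated

namespace IsUnitMesh

variable {n : ℕ} {w : ℕ → ℝ}

lemma isCellHomogeneous_abs_sub (hw : IsUnitMesh n w) :
    IsCellHomogeneous n w fun a b => |a - b| := by
  intro j hj a _ b _
  simp only [cellMap_sub, abs_mul, abs_of_pos (hw.pos j hj)]

lemma isCellQuasiMetric_abs_sub (hw : IsUnitMesh n w) :
    IsCellQuasiMetric n w fun a b => |a - b| where
  homogeneous := hw.isCellHomogeneous_abs_sub
  self a _ := by rw [sub_self, abs_zero]
  bounded := ⟨1, one_pos, fun a ha b hb => abs_sub_le_of_le_of_le ha.1 ha.2 hb.1 hb.2 |>.trans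
    (by norm_num)⟩
  triangle := ⟨1, zero_le_one, fun a b c => (abs_sub_le a c b).trans_eq (one_mul _).symm⟩

lemma isCellSeparated_abs_sub (hw : IsUnitMesh n w) :
    IsCellSeparated n w fun a b => |a - b| where
  homogeneous := hw.isCellHomogeneous_abs_sub
  nonneg _ _ _ _ := abs_nonneg _
  zero_one_pos := by norm_num
  nonadjacent := by
    obtain ⟨η, hη, hle⟩ := hw.exists_pos_forall_le
    refine ⟨η, hη, fun i j hij hj a ha b hb => ?_⟩
    have hi := (hw.cellMap_mem_Icc_meshNode (by omega : i < n) ha).2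
    have hnode := hw.meshNode_le (Nat.succ_le_of_lt hij) hj.le
    rw [Nat.succ_eq_add_one, meshNode_succ] at hnode
    rw [abs_sub_comm]
    linarith [le_abs_self (cellMap w j b - cellMap w i a), hle (i + 1) (hij.trans hj),
      (hw.cellMap_mem_Icc_meshNode hj hb).1]
  adjacent := by
    refine ⟨1, one_pos, fun i hi a ha b hb => ?_⟩
    have ha' := (hw.cellMap_mem_Icc_meshNode (by omega : i < n) ha).2
    have hb' := (hw.cellMap_mem_Icc_meshNode hi hb).1
    rw [cellMap_one, cellMap_zero, one_mul, abs_of_nonpos (sub_nonpos.2 ha'),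
      abs_of_nonpos (sub_nonpos.2 hb'), abs_of_nonpos (sub_nonpos.2 (ha'.trans hb'))]
    constructor <;> linarith

end IsUnitMesh

/-! ### Powers of distances -/

section DistRpow

variable {α X : Type*} [MetricSpace α] [MetricSpace X]

lemma dist_rpow_le_add (x y z : X) {s : ℝ} (hs : 0 ≤ s) :
    dist x y ^ s ≤ 2 ^ s * (dist x z ^ s + dist z y ^ s) := by
  have hmax : max (dist x z) (dist z y) ^ s ≤ dist x z ^ s + dist z y ^ s := by
    rcases max_choice (dist x z) (dist z y) with h | h <;> rw [h]
    · exact le_add_of_nonneg_right (Real.rpow_nonneg dist_nonneg s)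
    · exact le_add_of_nonneg_left (Real.rpow_nonneg dist_nonneg s)
  calc dist x y ^ s ≤ (2 * max (dist x z) (dist z y)) ^ s := by
        refine Real.rpow_le_rpow dist_nonneg ((dist_triangle x z y).trans ?_) hs
        linarith [le_max_left (dist x z) (dist z y), le_max_right (dist x z) (dist z y)]
    _ = 2 ^ s * max (dist x z) (dist z y) ^ s :=
        Real.mul_rpow zero_le_two (le_max_of_le_left dist_nonneg)
    _ ≤ _ := mul_le_mul_of_nonneg_left hmax (Real.rpow_nonneg zero_le_two s)

lemma dist_le_of_dist_rpow_le {x y : X} {s A B : ℝ} (hs : 0 < s) (hA : 0 ≤ A) (hB : 0 ≤ B)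
    (h : dist x y ^ s ≤ A * B) : dist x y ≤ A ^ (1 / s) * B ^ (1 / s) := by
  rw [← Real.mul_rpow hA hB, one_div]
  exact (Real.le_rpow_inv_iff_of_pos dist_nonneg (mul_nonneg hA hB) hs).2 h

lemma holderOnWith_of_dist_le {γ : α → X} {S : Set α} {C r : ℝ} (hC : 0 ≤ C) (hr : 0 ≤ r)
    (h : ∀ a ∈ S, ∀ b ∈ S, dist (γ a) (γ b) ≤ C * dist a b ^ r) :
    HolderOnWith (Real.toNNReal C) (Real.toNNReal r) γ S := by
  intro a ha b hb
  rw [edist_dist, edist_dist, Real.coe_toNNReal _ hr, ENNReal.ofReal_rpow_of_nonneg dist_nonneg hr]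
  change _ ≤ ENNReal.ofReal _ * _
  rw [← ENNReal.ofReal_mul hC]
  exact ENNReal.ofReal_le_ofReal (h a ha b hb)

lemma holderOnWith_of_dist_rpow_le {γ : α → X} {S : Set α} {s C : ℝ} (hs : 0 < s) (hC : 0 ≤ C)
    (h : ∀ a ∈ S, ∀ b ∈ S, dist (γ a) (γ b) ^ s ≤ C * dist a b) :
    HolderOnWith (Real.toNNReal (C ^ (1 / s))) (Real.toNNReal (1 / s)) γ S :=
  holderOnWith_of_dist_le (by positivity) (by positivity) fun a ha b hb =>
    dist_le_of_dist_rpow_le hs hC dist_nonneg (h a ha b hb)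

end DistRpow

/-! ### Chains of similarities -/

lemma exists_forall_eq_apply_of_contracting {α X : Type*} [MetricSpace X] {Λ : Set X}
    (hΛ : IsCompact Λ) (hne : Λ.Nonempty) {K : NNReal} (hK : K < 1) {T : α → X → X}
    (hmaps : ∀ t, MapsTo (T t) Λ Λ) (hT : ∀ t, LipschitzOnWith K (T t) Λ) (σ : α → α) :
    ∃ γ : α → X, (∀ t, γ t ∈ Λ) ∧ ∀ t, γ t = T t (γ (σ t)) := by
  let _ : TopologicalSpace α := ⊥
  have _ : DiscreteTopology α := ⟨rfl⟩
  have _ : CompactSpace Λ := isCompact_iff_compactSpace.1 hΛ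
  have _ : Nonempty (BoundedContinuousFunction α Λ) :=
    hne.to_subtype.map (BoundedContinuousFunction.const α)
  obtain ⟨D, hD⟩ := Metric.isBounded_iff.1 (isCompact_univ (X := Λ)).isBounded
  let Φ : BoundedContinuousFunction α Λ → BoundedContinuousFunction α Λ := fun γ =>
    BoundedContinuousFunction.mkOfDiscrete (fun t => (hmaps t).restrict _ _ _ (γ (σ t))) D
      fun _ _ => hD (mem_univ _) (mem_univ _)
  have hΦ : ContractingWith K Φ := by
    refine ⟨hK, LipschitzWith.of_dist_le_mul fun γ δ => ?_⟩
    refine (BoundedContinuousFunction.dist_le (by positivity)).2 fun t => ?_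
    exact ((hT t).dist_le_mul _ (γ (σ t)).2 _ (δ (σ t)).2).trans
      (mul_le_mul_of_nonneg_left
        (BoundedContinuousFunction.dist_coe_le_dist (f := γ) (g := δ) (σ t)) K.2)
  refine ⟨fun t => hΦ.fixedPoint Φ t, fun t => (hΦ.fixedPoint Φ t).2, fun t => ?_⟩
  exact congrArg Subtype.val (DFunLike.congr_fun hΦ.fixedPoint_isFixedPt t).symm

/-- The compact set `Λ` is the union of its images under the similarities `T 0, …, T (n - 1)`,
which map the base points `p 0, p n` to successive points of the chain `p 0, …, p n`. -/
structure IsSimilarityChain {X : Type*} [MetricSpace X] (n : ℕ) (p : ℕ → X) (T : ℕ → X → X)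
    (r : ℕ → ℝ) (Λ : Set X) : Prop where
  ratio_pos : ∀ j < n, 0 < r j
  ratio_lt_one : ∀ j < n, r j < 1
  dist_map : ∀ j < n, ∀ x y, dist (T j x) (T j y) = r j * dist x y
  map_first : ∀ j < n, T j (p 0) = p j
  map_last : ∀ j < n, T j (p n) = p (j + 1)
  isCompact : IsCompact Λ
  first_mem : p 0 ∈ Λ
  mapsTo : ∀ j < n, ∀ x ∈ Λ, T j x ∈ Λ
  exists_preimage : ∀ x ∈ Λ, ∃ j < n, ∃ y ∈ Λ, T j y = x

/-- The parametrization `γ` of points of `Λ` conjugates the cell maps of a subdivision of `[0, 1]`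
to the maps `T j`. -/
structure IsCellParametrization {X : Type*} (n : ℕ) (w : ℕ → ℝ) (p : ℕ → X) (T : ℕ → X → X)
    (Λ : Set X) (γ : ℝ → X) : Prop where
  map_zero : γ 0 = p 0
  map_one : γ 1 = p n
  mem : ∀ t, γ t ∈ Λ
  map_cell : ∀ j < n, ∀ u ∈ Icc (0 : ℝ) 1, γ (cellMap w j u) = T j (γ u)

namespace IsSimilarityChain

variable {X : Type*} [MetricSpace X] {n : ℕ} {p : ℕ → X} {T : ℕ → X → X} {r : ℕ → ℝ} {Λ : Set X}

lemma card_pos (h : IsSimilarityChain n p T r Λ) : 0 < n := by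
  obtain ⟨j, hj, -⟩ := h.exists_preimage _ h.first_mem
  exact j.zero_le.trans_lt hj

lemma one_lt_card (h : IsSimilarityChain n p T r Λ) (hsum : 1 < ∑ i ∈ Finset.range n, r i) :
    1 < n := by
  by_contra hn
  obtain rfl : n = 1 := by have := h.card_pos; omega
  rw [Finset.sum_range_one] at hsum
  exact hsum.not_gt (h.ratio_lt_one 0 one_pos)

lemma exists_lipschitzWith (h : IsSimilarityChain n p T r Λ) :
    ∃ K : NNReal, K < 1 ∧ ∀ j < n, LipschitzWith K (T j) := by
  obtain ⟨ρ, hρ1, hρ⟩ := exists_lt_forall_le_of_forall_lt h.ratio_lt_one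
  have hρ0 : 0 ≤ ρ := (h.ratio_pos 0 h.card_pos).le.trans (hρ 0 h.card_pos)
  refine ⟨⟨ρ, hρ0⟩, hρ1, fun j hj => LipschitzWith.of_dist_le_mul fun x y => ?_⟩
  rw [h.dist_map j hj]
  exact mul_le_mul_of_nonneg_right (hρ j hj) dist_nonneg

lemma isCompact_image (h : IsSimilarityChain n p T r Λ) {j : ℕ} (hj : j < n) :
    IsCompact (T j '' Λ) := by
  obtain ⟨K, -, hK⟩ := h.exists_lipschitzWith
  exact h.isCompact.image (hK j hj).continuous

lemma eq_of_fixed (h : IsSimilarityChain n p T r Λ) {j : ℕ} (hj : j < n) {x y : X}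
    (hx : T j x = x) (hy : T j y = y) : x = y := by
  have hd := h.dist_map j hj x y
  rw [hx, hy] at hd
  exact dist_eq_zero.1 (by nlinarith [h.ratio_lt_one j hj, dist_nonneg (x := x) (y := y)])

lemma subset_closure (h : IsSimilarityChain n p T r Λ) {A : Set X} (hA : A ⊆ Λ)
    (hne : A.Nonempty) (hmaps : ∀ j < n, ∀ x ∈ A, T j x ∈ A) : Λ ⊆ closure A := by
  obtain ⟨K, hK1, hK⟩ := h.exists_lipschitzWith
  obtain ⟨a, ha⟩ := hne
  have hnear : ∀ k : ℕ, ∀ x ∈ Λ, ∃ y ∈ A, dist x y ≤ (K : ℝ) ^ k * Metric.diam Λ := by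
    intro k
    induction k with
    | zero =>
      intro x hx
      exact ⟨a, ha, by simpa using Metric.dist_le_diam_of_mem h.isCompact.isBounded hx (hA ha)⟩
    | succ k ih =>
      intro x hx
      obtain ⟨j, hj, y, hy, rfl⟩ := h.exists_preimage x hx
      obtain ⟨b, hb, hd⟩ := ih y hy
      refine ⟨T j b, hmaps j hj b hb, ((hK j hj).dist_le_mul y b).trans ?_⟩
      rw [pow_succ', mul_assoc]
      exact mul_le_mul_of_nonneg_left hd K.2
  intro x hx
  rw [Metric.mem_closure_iff]
  intro ε hε
  have hlim : Tendsto (fun k : ℕ => (K : ℝ) ^ k * Metric.diam Λ) atTop (𝓝 0) := by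
    simpa using (tendsto_pow_atTop_nhds_zero_of_lt_one K.2 hK1).mul_const (Metric.diam Λ)
  obtain ⟨k, hk⟩ := (hlim.eventually (gt_mem_nhds hε)).exists
  obtain ⟨y, hy, hd⟩ := hnear k x hx
  exact ⟨y, hy, hd.trans_lt hk⟩

lemma map_eq_map_of_cellMap_eq (h : IsSimilarityChain n p T r Λ) {w : ℕ → ℝ}
    (hw : IsUnitMesh n w) {γ : ℝ → X} (hγ0 : γ 0 = p 0) (hγ1 : γ 1 = p n) {i j : ℕ} (hi : i < n)
    (hj : j < n) {u v : ℝ} (hu : u ∈ Icc (0 : ℝ) 1) (hv : v ∈ Icc (0 : ℝ) 1)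
    (huv : cellMap w i u = cellMap w j v) : T i (γ u) = T j (γ v) := by
  rcases lt_trichotomy i j with hlt | rfl | hlt
  · obtain ⟨rfl, rfl, rfl⟩ := hw.eq_of_cellMap_eq hlt hj hu hv huv
    rw [hγ0, hγ1, h.map_last i hi, h.map_first _ hj]
  · have hsub := cellMap_sub w i u v
    rw [huv, sub_self] at hsub
    rw [sub_eq_zero.1 ((mul_eq_zero.1 hsub.symm).resolve_left (hw.pos i hi).ne')]
  · obtain ⟨rfl, rfl, rfl⟩ := hw.eq_of_cellMap_eq hlt hi hv hu huv.symm
    rw [hγ0, hγ1, h.map_last j hj, h.map_first _ hi]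

lemma exists_isCellParametrization (h : IsSimilarityChain n p T r Λ) {w : ℕ → ℝ}
    (hw : IsUnitMesh n w) : ∃ γ, IsCellParametrization n w p T Λ γ := by
  obtain ⟨K, hK1, hK⟩ := h.exists_lipschitzWith
  have hsel : ∀ t : ℝ, ∃ j < n, ∃ u, t ∈ Icc (0 : ℝ) 1 → u ∈ Icc (0 : ℝ) 1 ∧ cellMap w j u = t := by
    intro t
    by_cases ht : t ∈ Icc (0 : ℝ) 1
    · obtain ⟨j, hj, u, hu⟩ := hw.exists_cellMap_eq ht
      exact ⟨j, hj, u, fun _ => hu⟩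
    · exact ⟨0, h.card_pos, 0, fun ht' => absurd ht' ht⟩
  choose J hJ σ hσ using hsel
  obtain ⟨γ, hmem, hγ⟩ := exists_forall_eq_apply_of_contracting h.isCompact ⟨_, h.first_mem⟩ hK1
    (fun t => h.mapsTo (J t) (hJ t)) (fun t => (hK (J t) (hJ t)).lipschitzOnWith) σ
  have hγ0 : γ 0 = p 0 := by
    obtain ⟨hu, he⟩ := hσ 0 ⟨le_rfl, zero_le_one⟩
    have hfix := hγ 0
    obtain ⟨hj, hz⟩ := hw.eq_of_cellMap_eq_zero (hJ 0) hu he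
    rw [hj, hz] at hfix
    exact h.eq_of_fixed h.card_pos hfix.symm (h.map_first 0 h.card_pos)
  have hγ1 : γ 1 = p n := by
    obtain ⟨hu, he⟩ := hσ 1 ⟨zero_le_one, le_rfl⟩
    have hfix := hγ 1
    obtain ⟨hj, hone⟩ := hw.eq_of_cellMap_eq_one (hJ 1) hu he
    rw [hone] at hfix
    exact h.eq_of_fixed (hJ 1) hfix.symm ((h.map_last _ (hJ 1)).trans (by rw [hj]))
  refine ⟨γ, hγ0, hγ1, hmem, fun j hj u hu => ?_⟩
  obtain ⟨hv, he⟩ := hσ _ (hw.cellMap_mem hj hu)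
  rw [hγ]
  exact h.map_eq_map_of_cellMap_eq hw hγ0 hγ1 (hJ _) hj hv hu he

lemma exists_isUnitMesh_rpow (h : IsSimilarityChain n p T r Λ)
    (hsum : 1 < ∑ i ∈ Finset.range n, r i) :
    ∃ s : ℝ, 1 < s ∧ IsUnitMesh n (fun j => r j ^ s) := by
  let φ : ℝ → ℝ := fun s => ∑ i ∈ Finset.range n, r i ^ s
  have hcont : Continuous φ := continuous_finsetSum _ fun i hi =>
    Real.continuous_const_rpow (h.ratio_pos i (Finset.mem_range.1 hi)).ne'
  have hlim : Tendsto φ atTop (𝓝 0) := by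
    rw [← Finset.sum_const_zero (s := Finset.range n)]
    refine tendsto_finsetSum _ fun i hi => ?_
    have hi' := Finset.mem_range.1 hi
    exact tendsto_rpow_atTop_of_base_lt_one _ (by linarith [h.ratio_pos i hi'])
      (h.ratio_lt_one i hi')
  obtain ⟨M, hM1, hM⟩ := ((eventually_ge_atTop (1 : ℝ)).and
    (hlim.eventually (gt_mem_nhds zero_lt_one))).exists
  have h1 : 1 < φ 1 := by simpa [φ] using hsum
  obtain ⟨s, hs, he⟩ := intermediate_value_Icc' hM1 hcont.continuousOn ⟨hM.le, h1.le⟩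
  refine ⟨s, lt_of_le_of_ne hs.1 ?_, fun j hj => Real.rpow_pos_of_pos (h.ratio_pos j hj) s, he⟩
  rintro rfl
  exact h1.ne' he

lemma exists_le_dist_of_disjoint (h : IsSimilarityChain n p T r Λ)
    (hdisj : ∀ i j, i + 1 < j → j < n → Disjoint (T i '' Λ) (T j '' Λ)) :
    ∃ δ > 0, ∀ i j, i + 1 < j → j < n → ∀ x ∈ Λ, ∀ y ∈ Λ, δ ≤ dist (T i x) (T j y) := by
  let P : Finset (ℕ × ℕ) := {ij ∈ Finset.range n ×ˢ Finset.range n | ij.1 + 1 < ij.2}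
  have hP : ∀ {ij}, ij ∈ P ↔ (ij.1 < n ∧ ij.2 < n) ∧ ij.1 + 1 < ij.2 := by simp [P]
  have hcompact : IsCompact (⋃ ij ∈ P, (T ij.1 '' Λ) ×ˢ (T ij.2 '' Λ)) :=
    P.isCompact_biUnion fun ij hij =>
      (h.isCompact_image (hP.1 hij).1.1).prod (h.isCompact_image (hP.1 hij).1.2)
  obtain ⟨δ, hδ, hle⟩ := hcompact.exists_forall_le' (f := fun x => dist x.1 x.2) (a := 0)
    (by fun_prop) fun x hx => by
      obtain ⟨ij, hij, hx1, hx2⟩ := mem_iUnion₂.1 hx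
      exact dist_pos.2 ((hdisj ij.1 ij.2 (hP.1 hij).2 (hP.1 hij).1.2).ne_of_mem hx1 hx2)
  exact ⟨δ, hδ, fun i j hij hj x hx y hy => hle (T i x, T j y) (mem_iUnion₂.2
    ⟨(i, j), hP.2 ⟨⟨by omega, hj⟩, hij⟩, mem_image_of_mem _ hx, mem_image_of_mem _ hy⟩)⟩

end IsSimilarityChain

/-- The map `γ` of `[0, 1]` onto `E` satisfies `c |a - b| ≤ dist (γ a) (γ b) ^ s ≤ C |a - b|`; in
other words it is bi-Lipschitz for the snowflake distance `|a - b| ^ (1 / s)` on `[0, 1]`. -/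
structure IsSnowflakeParametrization {X : Type*} [MetricSpace X] (s c C : ℝ) (γ : ℝ → X)
    (E : Set X) : Prop where
  one_lt : 1 < s
  c_pos : 0 < c
  image_eq : γ '' Icc 0 1 = E
  lower : ∀ a ∈ Icc (0 : ℝ) 1, ∀ b ∈ Icc (0 : ℝ) 1, c * |a - b| ≤ dist (γ a) (γ b) ^ s
  upper : ∀ a ∈ Icc (0 : ℝ) 1, ∀ b ∈ Icc (0 : ℝ) 1, dist (γ a) (γ b) ^ s ≤ C * |a - b|

namespace IsCellParametrization

variable {X : Type*} [MetricSpace X] {n : ℕ} {p : ℕ → X} {T : ℕ → X → X} {r : ℕ → ℝ} {Λ : Set X}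
  {s : ℝ} {γ : ℝ → X}

lemma image_eq (hγ : IsCellParametrization n (fun j => r j ^ s) p T Λ γ)
    (hw : IsUnitMesh n fun j => r j ^ s) (h : IsSimilarityChain n p T r Λ)
    (hcont : ContinuousOn γ (Icc 0 1)) : γ '' Icc 0 1 = Λ := by
  have hsub : γ '' Icc 0 1 ⊆ Λ := image_subset_iff.2 fun t _ => hγ.mem t
  refine hsub.antisymm ((h.subset_closure hsub ⟨_, 0, ⟨le_rfl, zero_le_one⟩, rfl⟩ ?_).trans
    (isCompact_Icc.image_of_continuousOn hcont).isClosed.closure_subset)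
  rintro j hj _ ⟨u, hu, rfl⟩
  exact ⟨cellMap _ j u, hw.cellMap_mem hj hu, hγ.map_cell j hj u hu⟩

lemma isCellHomogeneous_dist_rpow (hγ : IsCellParametrization n (fun j => r j ^ s) p T Λ γ)
    (h : IsSimilarityChain n p T r Λ) :
    IsCellHomogeneous n (fun j => r j ^ s) fun a b => dist (γ a) (γ b) ^ s := by
  intro j hj a ha b hb
  simp only [hγ.map_cell j hj a ha, hγ.map_cell j hj b hb, h.dist_map j hj,
    Real.mul_rpow (h.ratio_pos j hj).le dist_nonneg]

lemma isCellQuasiMetric_dist_rpow (hγ : IsCellParametrization n (fun j => r j ^ s) p T Λ γ)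
    (h : IsSimilarityChain n p T r Λ) (hs : 0 < s) :
    IsCellQuasiMetric n (fun j => r j ^ s) fun a b => dist (γ a) (γ b) ^ s where
  homogeneous := hγ.isCellHomogeneous_dist_rpow h
  self a _ := by rw [dist_self, Real.zero_rpow hs.ne']
  bounded := by
    refine ⟨(Metric.diam Λ + 1) ^ s, Real.rpow_pos_of_pos (by positivity) s, fun a _ b _ =>
      Real.rpow_le_rpow dist_nonneg ?_ hs.le⟩
    exact (Metric.dist_le_diam_of_mem h.isCompact.isBounded (hγ.mem a) (hγ.mem b)).trans
      (le_add_of_nonneg_right zero_le_one)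
  triangle := ⟨2 ^ s, by positivity, fun a b c => dist_rpow_le_add _ _ _ hs.le⟩

lemma isCellSeparated_dist_rpow (hγ : IsCellParametrization n (fun j => r j ^ s) p T Λ γ)
    (h : IsSimilarityChain n p T r Λ) (hs : 0 < s) (hne : p 0 ≠ p n)
    (hdisj : ∀ i j, i + 1 < j → j < n → Disjoint (T i '' Λ) (T j '' Λ)) {K : ℝ} (hK0 : 0 ≤ K)
    (hK : ∀ i, i + 1 < n → ∀ x ∈ Λ, ∀ y ∈ Λ,
      dist (T i x) (p (i + 1)) ≤ K * dist (T i x) (T (i + 1) y)) :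
    IsCellSeparated n (fun j => r j ^ s) fun a b => dist (γ a) (γ b) ^ s where
  homogeneous := hγ.isCellHomogeneous_dist_rpow h
  nonneg _ _ _ _ := Real.rpow_nonneg dist_nonneg s
  zero_one_pos := Real.rpow_pos_of_pos (by rw [hγ.map_zero, hγ.map_one]; exact dist_pos.2 hne) s
  nonadjacent := by
    obtain ⟨δ, hδ, hle⟩ := h.exists_le_dist_of_disjoint hdisj
    refine ⟨δ ^ s, Real.rpow_pos_of_pos hδ s, fun i j hij hj a ha b hb => ?_⟩
    rw [hγ.map_cell i (by omega) a ha, hγ.map_cell j hj b hb]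
    exact Real.rpow_le_rpow hδ.le (hle i j hij hj _ (hγ.mem a) _ (hγ.mem b)) hs.le
  adjacent := by
    refine ⟨(K + 1) ^ s, Real.rpow_pos_of_pos (by positivity) s, fun i hi a ha b hb => ?_⟩
    have hi' : i < n := by omega
    rw [hγ.map_cell i hi' a ha, hγ.map_cell _ hi b hb, hγ.map_cell i hi' 1 ⟨zero_le_one, le_rfl⟩,
      hγ.map_cell _ hi 0 ⟨le_rfl, zero_le_one⟩, hγ.map_one, hγ.map_zero, h.map_last i hi',
      h.map_first _ hi, ← Real.mul_rpow (by positivity) dist_nonneg]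
    have hnode := hK i hi _ (hγ.mem a) _ (hγ.mem b)
    have htri := dist_triangle_left (p (i + 1)) (T (i + 1) (γ b)) (T i (γ a))
    have hpos := dist_nonneg (x := T i (γ a)) (y := T (i + 1) (γ b))
    exact ⟨Real.rpow_le_rpow dist_nonneg (by linarith) hs.le,
      Real.rpow_le_rpow dist_nonneg (by linarith) hs.le⟩

end IsCellParametrization

theorem IsSimilarityChain.exists_isSnowflakeParametrization {X : Type*} [MetricSpace X] {n : ℕ}
    {p : ℕ → X} {T : ℕ → X → X} {r : ℕ → ℝ} {Λ : Set X} (h : IsSimilarityChain n p T r Λ)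
    (hsum : 1 < ∑ i ∈ Finset.range n, r i) (hne : p 0 ≠ p n)
    (hdisj : ∀ i j, i + 1 < j → j < n → Disjoint (T i '' Λ) (T j '' Λ)) {K : ℝ} (hK0 : 0 ≤ K)
    (hK : ∀ i, i + 1 < n → ∀ x ∈ Λ, ∀ y ∈ Λ,
      dist (T i x) (p (i + 1)) ≤ K * dist (T i x) (T (i + 1) y)) :
    ∃ (s c C : ℝ) (γ : ℝ → X), IsSnowflakeParametrization s c C γ Λ ∧ γ 0 = p 0 := by
  have hn := h.one_lt_card hsum
  obtain ⟨s, hs, hw⟩ := h.exists_isUnitMesh_rpow hsum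
  obtain ⟨γ, hγ⟩ := h.exists_isCellParametrization hw
  have hs0 : 0 < s := zero_lt_one.trans hs
  obtain ⟨C, hC, hupper⟩ := hw.isCellSeparated_abs_sub.exists_le_mul hw hn
    (hγ.isCellQuasiMetric_dist_rpow h hs0)
  obtain ⟨c, hc, hlower⟩ := (hγ.isCellSeparated_dist_rpow h hs0 hne hdisj hK0 hK).exists_le_mul hw
    hn hw.isCellQuasiMetric_abs_sub
  have hupper' : ∀ a ∈ Icc (0 : ℝ) 1, ∀ b ∈ Icc (0 : ℝ) 1,
      dist (γ a) (γ b) ^ s ≤ C * |a - b| := by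
    intro a ha b hb
    rcases le_total a b with hab | hab
    · exact hupper a ha b hb hab
    · rw [dist_comm, abs_sub_comm]; exact hupper b hb a ha hab
  have hlower' : ∀ a ∈ Icc (0 : ℝ) 1, ∀ b ∈ Icc (0 : ℝ) 1,
      c⁻¹ * |a - b| ≤ dist (γ a) (γ b) ^ s := by
    intro a ha b hb
    rw [inv_mul_le_iff₀ hc]
    rcases le_total a b with hab | hab
    · exact hlower a ha b hb hab
    · rw [dist_comm, abs_sub_comm]; exact hlower b hb a ha hab
  have hcont : ContinuousOn γ (Icc 0 1) :=
    (holderOnWith_of_dist_rpow_le hs0 hC.le hupper').continuousOn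
      (Real.toNNReal_pos.2 (one_div_pos.2 hs0))
  exact ⟨s, c⁻¹, C, γ, ⟨hs, inv_pos.2 hc, hγ.image_eq hw h hcont, hlower', hupper'⟩, hγ.map_zero⟩

/-! ### Functions that are Hölder of exponent greater than one -/

section HolderExtension

lemma exists_measurable_holder_extension {X : Type*} [MetricSpace X] [MeasurableSpace X]
    [BorelSpace X] {E : Set X} (hE : E.Nonempty) {f : X → ℝ} {s C : ℝ} (hs : 0 ≤ s) (hC : 0 ≤ C)
    (hf : ∀ x ∈ E, ∀ y ∈ E, |f x - f y| ≤ C * dist x y ^ s) :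
    ∃ g : X → ℝ, Measurable g ∧
      ∃ B, 0 ≤ B ∧ ∀ x, ∀ y ∈ E, |g x - f y| ≤ B * dist x y ^ s := by
  set B : ℝ := C * 2 ^ s with hB
  have hlow : ∀ x, ∀ y ∈ E, ∀ y' ∈ E, f y - B * dist x y ^ s ≤ f y' + B * dist x y' ^ s := by
    intro x y hy y' hy'
    have hyy' := mul_le_mul_of_nonneg_left (dist_rpow_le_add y y' x hs) hC
    rw [← mul_assoc, ← hB, mul_add, dist_comm y x] at hyy'
    linarith [(abs_le.1 (hf y hy y' hy')).2]
  have hbdd : ∀ x, BddBelow (range fun y : E => f y + B * dist x (y : X) ^ s) := by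
    intro x
    obtain ⟨y, hy⟩ := hE
    exact ⟨f y - B * dist x y ^ s, forall_mem_range.2 fun y' => hlow x y hy y' y'.2⟩
  have hcont : ∀ y : E, Continuous fun x => f y + B * dist x (y : X) ^ s := fun y =>
    continuous_const.add (continuous_const.mul
      ((continuous_id.dist continuous_const).rpow_const fun _ => Or.inr hs))
  have : Nonempty E := hE.to_subtype
  refine ⟨fun x => ⨅ y : E, (f y + B * dist x y ^ s),
    (upperSemicontinuous_ciInf hbdd fun y => (hcont y).upperSemicontinuous).measurable, B,
    by positivity, fun x y hy => abs_le.2 ⟨?_, ?_⟩⟩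
  · linarith [le_ciInf fun y' : E => hlow x y hy y' y'.2]
  · linarith [ciInf_le (hbdd x) ⟨y, hy⟩]

lemma locallyIntegrable_of_abs_sub_le_dist_rpow {X : Type*} [MetricSpace X] [MeasurableSpace X]
    [BorelSpace X] {μ : Measure X} [IsLocallyFiniteMeasure μ] {g : X → ℝ} {y : X} {c B s : ℝ}
    (hs : 0 ≤ s) (hg : AEStronglyMeasurable g μ) (h : ∀ x, |g x - c| ≤ B * dist x y ^ s) :
    LocallyIntegrable g μ := by
  have hcont : Continuous fun x => |c| + B * dist x y ^ s :=
    continuous_const.add (continuous_const.mul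
      ((continuous_id.dist continuous_const).rpow_const fun _ => Or.inr hs))
  refine hcont.locallyIntegrable.mono hg (Eventually.of_forall fun x => ?_)
  rw [Real.norm_eq_abs, Real.norm_eq_abs]
  linarith [h x, abs_sub_abs_le_abs_sub (g x) c, le_abs_self (|c| + B * dist x y ^ s)]

variable {V : Type*} [NormedAddCommGroup V] [NormedSpace ℝ V] {A δ : ℝ} {g G : V → ℝ}

/-- `G` is a smoothing of `g` at scale `δ`: wherever `g` is within `ε` of a constant on a ball of
radius `δ`, so is `G` at the centre, and the derivative of `G` there is at most `A * ε / δ`. -/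
structure IsMollification (A δ : ℝ) (g G : V → ℝ) : Prop where
  contDiff : ContDiff ℝ 1 G
  abs_sub_le : ∀ x c ε, (∀ y ∈ Metric.ball x δ, |g y - c| ≤ ε) → |G x - c| ≤ ε
  norm_fderiv_le : ∀ x c ε, (∀ y ∈ Metric.ball x δ, |g y - c| ≤ ε) →
    ‖fderiv ℝ G x‖ ≤ A * ε / δ

lemma IsMollification.differentiable (h : IsMollification A δ g G) : Differentiable ℝ G :=
  h.contDiff.differentiable one_ne_zero

lemma IsMollification.comp_smul (h : IsMollification A 1 (fun x => g (δ • x)) G) (hδ : 0 < δ) :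
    IsMollification A δ g fun x => G (δ⁻¹ • x) := by
  have hball : ∀ {x : V} {c ε : ℝ}, (∀ y ∈ Metric.ball x δ, |g y - c| ≤ ε) →
      ∀ y ∈ Metric.ball (δ⁻¹ • x) 1, |g (δ • y) - c| ≤ ε := by
    intro x c ε hx y hy
    refine hx _ ?_
    rw [mem_ball_iff_norm] at hy ⊢
    rw [← smul_inv_smul₀ hδ.ne' x, ← smul_sub, norm_smul, Real.norm_of_nonneg hδ.le]
    exact mul_lt_of_lt_one_right hδ hy
  refine ⟨h.contDiff.comp (contDiff_const_smul δ⁻¹), fun x c ε hx => h.abs_sub_le _ _ _ (hball hx),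
    fun x c ε hx => ?_⟩
  rw [fderiv_comp_smul, norm_smul, Real.norm_of_nonneg (inv_nonneg.2 hδ.le), div_eq_inv_mul]
  exact mul_le_mul_of_nonneg_left
    (by simpa only [div_one] using h.norm_fderiv_le _ _ _ (hball hx)) (inv_nonneg.2 hδ.le)

section Measure

variable [FiniteDimensional ℝ V] [MeasurableSpace V] [BorelSpace V] {μ : Measure V}
  [μ.IsAddHaarMeasure]

lemma locallyIntegrable_comp_smul (hg : LocallyIntegrable g μ) (hδ : δ ≠ 0) :
    LocallyIntegrable (fun x => g (δ • x)) μ := by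
  have hmap : LocallyIntegrable g (μ.map (Homeomorph.smulOfNeZero δ hδ)) := by
    change LocallyIntegrable g (μ.map (δ • ·))
    rw [Measure.map_addHaar_smul μ hδ]
    exact fun x => (hg x).imp fun s hs => ⟨hs.1, by
      rw [IntegrableOn, Measure.restrict_smul]
      exact hs.2.smul_measure ENNReal.ofReal_ne_top⟩
  exact (locallyIntegrable_map_homeomorph _).1 hmap

open ContinuousLinearMap in
lemma norm_fderiv_convolution_le {φ : V → ℝ} (hφ : HasCompactSupport φ) (hφc : ContDiff ℝ 1 φ)
    (hsupp : tsupport φ ⊆ Metric.ball 0 δ) (hg : LocallyIntegrable g μ) {x : V} {c ε : ℝ}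
    (hδ : 0 < δ) (h : ∀ y ∈ Metric.ball x δ, |g y - c| ≤ ε) :
    ‖fderiv ℝ (φ ⋆[lsmul ℝ ℝ, μ] g) x‖ ≤ (∫ t, ‖fderiv ℝ φ t‖ ∂μ) * ε := by
  set L : ℝ →L[ℝ] ℝ →L[ℝ] ℝ := lsmul ℝ ℝ
  have hε : 0 ≤ ε := (abs_nonneg _).trans (h x (Metric.mem_ball_self hδ))
  have hint : Integrable (fderiv ℝ φ) μ :=
    (hφc.continuous_fderiv one_ne_zero).integrable_of_hasCompactSupport (hφ.fderiv ℝ)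
  -- The integral is the derivative of the constant function `φ ⋆ c`.
  have hzero : ∫ t, L.precompL V (fderiv ℝ φ t) c ∂μ = 0 := by
    have hconst : (φ ⋆[L, μ] fun _ => c) = fun _ => ∫ t, L (φ t) c ∂μ := rfl
    have hderiv := hφ.hasFDerivAt_convolution_left L hφc (μ := μ) (locallyIntegrable_const c) x
    rw [hconst] at hderiv
    exact hderiv.unique (hasFDerivAt_const _ _)
  have hdist := dist_convolution_le' (L.precompL V) hε hint ((support_fderiv_subset ℝ).trans hsupp)
    hg.aestronglyMeasurable (z₀ := c) h
  rw [hzero, dist_zero_right] at hdist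
  rw [(hφ.hasFDerivAt_convolution_left L hφc hg x).fderiv]
  refine hdist.trans (mul_le_mul_of_nonneg_right ?_ hε)
  exact mul_le_of_le_one_left (integral_nonneg fun _ => norm_nonneg _)
    ((norm_precompL_le V L).trans opNorm_lsmul_le)

variable (V μ) in
lemma exists_isMollification : ∃ A, 0 ≤ A ∧ ∀ δ > 0, ∀ g : V → ℝ, LocallyIntegrable g μ →
    ∃ G, IsMollification A δ g G := by
  let b : ContDiffBump (0 : V) := ⟨1 / 4, 1 / 2, by norm_num, by norm_num⟩
  have hsupp : tsupport (b.normed μ) ⊆ Metric.ball 0 1 := by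
    rw [b.tsupport_normed_eq]
    exact Metric.closedBall_subset_ball (by norm_num)
  have hφc : ContDiff ℝ 1 (b.normed μ) := b.contDiff_normed
  refine ⟨∫ t, ‖fderiv ℝ (b.normed μ) t‖ ∂μ, integral_nonneg fun _ => norm_nonneg _,
    fun δ hδ g hg => ?_⟩
  have hgδ := locallyIntegrable_comp_smul hg hδ.ne'
  refine ⟨_, IsMollification.comp_smul ⟨b.hasCompactSupport_normed.contDiff_convolution_left
    (ContinuousLinearMap.lsmul ℝ ℝ) hφc hgδ, fun x c ε h => ?_, fun x c ε h => ?_⟩ hδ⟩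
  · exact dist_convolution_le ((abs_nonneg _).trans (h x (Metric.mem_ball_self one_pos)))
      ((subset_tsupport _).trans hsupp) b.nonneg_normed b.integral_normed
      hgδ.aestronglyMeasurable h
  · rw [div_one]
    exact norm_fderiv_convolution_le b.hasCompactSupport_normed hφc hsupp hgδ one_pos h

end Measure

/-- A smooth cutoff function at scale `δ`: it is `1` to first order on `E` and vanishes to first
order at distance `3 * δ` from `E`. -/
structure IsCutoff (A δ : ℝ) (E : Set V) (χ : V → ℝ) : Prop where
  contDiff : ContDiff ℝ 1 χ
  abs_le_one : ∀ x, |χ x| ≤ 1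
  norm_fderiv_le : ∀ x, ‖fderiv ℝ χ x‖ ≤ A / δ
  eq_one : ∀ x ∈ E, χ x = 1
  fderiv_eq_zero_of_mem : ∀ x ∈ E, fderiv ℝ χ x = 0
  eq_zero : ∀ x, 3 * δ ≤ Metric.infDist x E → χ x = 0
  fderiv_eq_zero : ∀ x, 3 * δ ≤ Metric.infDist x E → fderiv ℝ χ x = 0

lemma IsMollification.isCutoff {E : Set V} {χ : V → ℝ} (hδ : 0 < δ)
    (h : IsMollification A δ (indicator {x | Metric.infDist x E < 2 * δ} 1) χ) :
    IsCutoff A δ E χ := by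
  set S : Set V := {x | Metric.infDist x E < 2 * δ}
  have hone : ∀ x, ∀ y ∈ Metric.ball x δ, |S.indicator (1 : V → ℝ) y - 0| ≤ 1 := by
    intro x y _
    by_cases hy : y ∈ S <;> simp [hy]
  have hmem : ∀ x ∈ E, ∀ y ∈ Metric.ball x δ, |S.indicator (1 : V → ℝ) y - 1| ≤ 0 := by
    intro x hx y hy
    have hy' : y ∈ S := by
      change Metric.infDist y E < 2 * δ
      linarith [Metric.infDist_le_dist_of_mem (x := y) hx, Metric.mem_ball.1 hy]
    simp [hy']
  have hfar : ∀ x, 3 * δ ≤ Metric.infDist x E →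
      ∀ y ∈ Metric.ball x δ, |S.indicator (1 : V → ℝ) y - 0| ≤ 0 := by
    intro x hx y hy
    have hy' : y ∉ S := by
      change ¬ Metric.infDist y E < 2 * δ
      linarith [Metric.infDist_le_infDist_add_dist (s := E) (x := x) (y := y),
        Metric.mem_ball'.1 hy]
    simp [hy']
  refine ⟨h.contDiff, fun x => ?_, fun x => ?_, fun x hx => ?_, fun x hx => ?_, fun x hx => ?_,
    fun x hx => ?_⟩
  · simpa only [sub_zero] using h.abs_sub_le x 0 1 (hone x)
  · simpa only [mul_one] using h.norm_fderiv_le x 0 1 (hone x)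
  · exact sub_eq_zero.1 (abs_nonpos_iff.1 (h.abs_sub_le x 1 0 (hmem x hx)))
  · exact norm_le_zero_iff.1 (by simpa using h.norm_fderiv_le x 1 0 (hmem x hx))
  · simpa using h.abs_sub_le x 0 0 (hfar x hx)
  · exact norm_le_zero_iff.1 (by simpa using h.norm_fderiv_le x 0 0 (hfar x hx))

section CutoffMul

variable {E : Set V} {χ d : V → ℝ}

lemma IsCutoff.fderiv_mul (h : IsCutoff A δ E χ) (hd : Differentiable ℝ d) (x : V) :
    fderiv ℝ (χ * d) x = χ x • fderiv ℝ d x + d x • fderiv ℝ χ x :=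
  ((h.contDiff.differentiable one_ne_zero x).hasFDerivAt.mul (hd x).hasFDerivAt).fderiv

lemma IsCutoff.mul_apply_of_mem (h : IsCutoff A δ E χ) {x : V} (hx : x ∈ E) :
    (χ * d) x = d x := by
  rw [Pi.mul_apply, h.eq_one x hx, one_mul]

lemma IsCutoff.fderiv_mul_of_mem (h : IsCutoff A δ E χ) (hd : Differentiable ℝ d) {x : V}
    (hx : x ∈ E) : fderiv ℝ (χ * d) x = fderiv ℝ d x := by
  rw [h.fderiv_mul hd, h.eq_one x hx, h.fderiv_eq_zero_of_mem x hx, one_smul, smul_zero, add_zero]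

lemma IsCutoff.abs_mul_le (h : IsCutoff A δ E χ) {a : ℝ} (ha : 0 ≤ a)
    (hda : ∀ x, Metric.infDist x E < 3 * δ → |d x| ≤ a) (x : V) : |(χ * d) x| ≤ a := by
  rcases le_or_gt (3 * δ) (Metric.infDist x E) with hx | hx
  · rw [Pi.mul_apply, h.eq_zero x hx, zero_mul, abs_zero]
    exact ha
  · rw [Pi.mul_apply, abs_mul]
    exact (mul_le_of_le_one_left (abs_nonneg _) (h.abs_le_one x)).trans (hda x hx)

lemma IsCutoff.norm_fderiv_mul_le (h : IsCutoff A δ E χ) (hd : Differentiable ℝ d) {a b : ℝ}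
    (ha : 0 ≤ a) (hb : 0 ≤ b) (hda : ∀ x, Metric.infDist x E < 3 * δ → |d x| ≤ a)
    (hdb : ∀ x, Metric.infDist x E < 3 * δ → ‖fderiv ℝ d x‖ ≤ b) (x : V) :
    ‖fderiv ℝ (χ * d) x‖ ≤ b + a * (A / δ) := by
  have hA : 0 ≤ A / δ := (norm_nonneg _).trans (h.norm_fderiv_le x)
  rw [h.fderiv_mul hd]
  rcases le_or_gt (3 * δ) (Metric.infDist x E) with hx | hx
  · rw [h.eq_zero x hx, h.fderiv_eq_zero x hx, zero_smul, smul_zero, add_zero, norm_zero]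
    positivity
  · refine (norm_add_le _ _).trans ?_
    rw [norm_smul, norm_smul, Real.norm_eq_abs, Real.norm_eq_abs]
    exact add_le_add
      ((mul_le_of_le_one_left (norm_nonneg _) (h.abs_le_one x)).trans (hdb x hx))
      (mul_le_mul (hda x hx) (h.norm_fderiv_le x) (norm_nonneg _) ha)

end CutoffMul

lemma tsum_eq_of_telescoping {W : Type*} [NormedAddCommGroup W] {a b : ℕ → W} {l : W}
    (hb : Summable b) (hab : ∀ n, b n = a (n + 1) - a n) (ha : Tendsto a atTop (𝓝 l)) :
    ∑' n, b n = l - a 0 := by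
  have hsum := hb.hasSum.tendsto_sum_nat
  simp only [hab, Finset.sum_range_sub] at hsum
  simpa only [hab] using tendsto_nhds_unique hsum (ha.sub_const _)

lemma exists_contDiff_of_telescoping {E : Set V} {f : V → ℝ} {Φ u : ℕ → V → ℝ} {v : ℕ → ℝ}
    (hΦ : ContDiff ℝ 1 (Φ 0)) (hu : ∀ n, ContDiff ℝ 1 (u n)) (hv : Summable v)
    (huv : ∀ n x, |u n x| ≤ v n) (hduv : ∀ n x, ‖fderiv ℝ (u n) x‖ ≤ v n)
    (huE : ∀ n, ∀ x ∈ E, u n x = Φ (n + 1) x - Φ n x)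
    (hduE : ∀ n, ∀ x ∈ E, fderiv ℝ (u n) x = fderiv ℝ (Φ (n + 1)) x - fderiv ℝ (Φ n) x)
    (hlim : ∀ x ∈ E, Tendsto (Φ · x) atTop (𝓝 (f x)))
    (hdlim : ∀ x ∈ E, Tendsto (fun n => fderiv ℝ (Φ n) x) atTop (𝓝 0)) :
    ∃ F : V → ℝ, ContDiff ℝ 1 F ∧ (∀ x ∈ E, F x = f x) ∧ ∀ x ∈ E, fderiv ℝ F x = 0 := by
  have hsum : ∀ x, Summable fun n => u n x := fun x => hv.of_norm_bounded fun n => huv n x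
  have hdsum : ∀ x, Summable fun n => fderiv ℝ (u n) x := fun x =>
    hv.of_norm_bounded fun n => hduv n x
  have hcont : ContDiff ℝ 1 fun x => ∑' n, u n x := by
    refine contDiff_tsum (v := fun _ => v) hu (fun _ _ => hv) fun k n x hk => ?_
    have hk' : k ≤ 1 := by exact_mod_cast hk
    interval_cases k
    · rw [norm_iteratedFDeriv_zero]; exact huv n x
    · rw [norm_iteratedFDeriv_one]; exact hduv n x
  have hderiv : ∀ x, HasFDerivAt (fun x => ∑' n, u n x) (∑' n, fderiv ℝ (u n) x) x :=
    hasFDerivAt_tsum hv (fun n y => ((hu n).differentiable one_ne_zero y).hasFDerivAt) hduv (hsum 0)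
  refine ⟨fun x => Φ 0 x + ∑' n, u n x, hΦ.add hcont, fun x hx => ?_, fun x hx => ?_⟩
  · simp only [tsum_eq_of_telescoping (hsum x) (fun n => huE n x hx) (hlim x hx), add_sub_cancel]
  · rw [((hΦ.differentiable one_ne_zero x).hasFDerivAt.fun_add (hderiv x)).fderiv,
      tsum_eq_of_telescoping (hdsum x) (fun n => hduE n x hx) (hdlim x hx), zero_sub,
      add_neg_cancel]

section NearbyBounds

variable {E : Set V} {f : V → ℝ} {B s η : ℝ} {G' : V → ℝ}

lemma IsMollification.abs_sub_le_of_dist_le (h : IsMollification A η g G) (hs : 0 ≤ s)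
    (hB : 0 ≤ B) (hηδ : η ≤ δ) {x y : V} (hg : ∀ z, |g z - f y| ≤ B * dist z y ^ s)
    (hxy : dist x y ≤ 3 * δ) :
    |G x - f y| ≤ B * (4 * δ) ^ s ∧ ‖fderiv ℝ G x‖ ≤ A * (B * (4 * δ) ^ s) / η := by
  have hball : ∀ z ∈ Metric.ball x η, |g z - f y| ≤ B * (4 * δ) ^ s := by
    intro z hz
    have hzy : dist z y ≤ 4 * δ := by
      linarith [dist_triangle z x y, Metric.mem_ball.1 hz]
    exact (hg z).trans
      (mul_le_mul_of_nonneg_left (Real.rpow_le_rpow dist_nonneg hzy hs) hB)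
  exact ⟨h.abs_sub_le _ _ _ hball, h.norm_fderiv_le _ _ _ hball⟩

lemma IsMollification.sub_le_of_infDist_lt (h : IsMollification A δ g G)
    (h' : IsMollification A (δ / 2) g G') (hE : E.Nonempty) (hs : 0 ≤ s) (hB : 0 ≤ B) (hδ : 0 < δ)
    (hg : ∀ z, ∀ y ∈ E, |g z - f y| ≤ B * dist z y ^ s) {x : V}
    (hx : Metric.infDist x E < 3 * δ) :
    |(G' - G) x| ≤ 2 * (B * (4 * δ) ^ s) ∧
      ‖fderiv ℝ (G' - G) x‖ ≤ 3 * A * (B * (4 * δ) ^ s) / δ := by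
  obtain ⟨y, hy, hxy⟩ := (Metric.infDist_lt_iff hE).1 hx
  obtain ⟨hG, hdG⟩ := h.abs_sub_le_of_dist_le hs hB le_rfl (hg · y hy) hxy.le
  obtain ⟨hG', hdG'⟩ := h'.abs_sub_le_of_dist_le hs hB (half_le_self hδ.le) (hg · y hy) hxy.le
  constructor
  · have := _root_.abs_sub_le (G' x) (f y) (G x)
    rw [abs_sub_comm (f y)] at this
    rw [Pi.sub_apply]
    linarith
  · rw [fderiv_sub (h'.differentiable x) (h.differentiable x)]
    refine (norm_sub_le _ _).trans ((add_le_add hdG' hdG).trans_eq ?_)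
    field_simp
    ring

end NearbyBounds

lemma mul_four_mul_two_inv_pow_rpow (B s : ℝ) (n : ℕ) :
    B * (4 * (1 / 2 : ℝ) ^ n) ^ s = B * 4 ^ s * ((1 / 2) ^ (s - 1)) ^ n * (1 / 2) ^ n := by
  rw [Real.mul_rpow (by norm_num) (by positivity), mul_assoc B, mul_assoc B, mul_assoc, ← mul_pow,
    ← Real.rpow_add_one (by norm_num), sub_add_cancel, ← Real.rpow_natCast, ← Real.rpow_mul
    (by norm_num), ← Real.rpow_natCast, ← Real.rpow_mul (by norm_num), mul_comm (n : ℝ)]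

lemma exists_contDiff_of_isCutoff {E : Set V} {f : V → ℝ} {Φ χ : ℕ → V → ℝ} {δ a b : ℕ → ℝ}
    (hΦ : ∀ n, ContDiff ℝ 1 (Φ n)) (hχ : ∀ n, IsCutoff A (δ n) E (χ n)) (ha : ∀ n, 0 ≤ a n)
    (hb : ∀ n, 0 ≤ b n) (hsum : Summable a) (hdsum : Summable fun n => b n + a n * (A / δ n))
    (hnear : ∀ n x, Metric.infDist x E < 3 * δ n →
      |(Φ (n + 1) - Φ n) x| ≤ a n ∧ ‖fderiv ℝ (Φ (n + 1) - Φ n) x‖ ≤ b n)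
    (hlim : ∀ x ∈ E, Tendsto (Φ · x) atTop (𝓝 (f x)))
    (hdlim : ∀ x ∈ E, Tendsto (fun n => fderiv ℝ (Φ n) x) atTop (𝓝 0)) :
    ∃ F : V → ℝ, ContDiff ℝ 1 F ∧ (∀ x ∈ E, F x = f x) ∧ ∀ x ∈ E, fderiv ℝ F x = 0 := by
  have hcont : ∀ n, ContDiff ℝ 1 (Φ (n + 1) - Φ n) := fun n => (hΦ _).sub (hΦ _)
  have hdiff : ∀ n, Differentiable ℝ (Φ n) := fun n => (hΦ n).differentiable one_ne_zero
  have hA : ∀ n, 0 ≤ A / δ n := fun n => (norm_nonneg _).trans ((hχ n).norm_fderiv_le 0)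
  refine exists_contDiff_of_telescoping (u := fun n => χ n * (Φ (n + 1) - Φ n)) (hΦ 0)
    (fun n => (hχ n).contDiff.mul (hcont n)) (hsum.add hdsum) (fun n x => ?_) (fun n x => ?_)
    (fun n x hx => (hχ n).mul_apply_of_mem hx) (fun n x hx => ?_) hlim hdlim
  · exact ((hχ n).abs_mul_le (ha n) (fun y hy => (hnear n y hy).1) x).trans
      (le_add_of_nonneg_right (add_nonneg (hb n) (mul_nonneg (ha n) (hA n))))
  · exact ((hχ n).norm_fderiv_mul_le ((hcont n).differentiable one_ne_zero) (ha n) (hb n)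
      (fun y hy => (hnear n y hy).1) (fun y hy => (hnear n y hy).2) x).trans
      (le_add_of_nonneg_left (ha n))
  · rw [(hχ n).fderiv_mul_of_mem ((hcont n).differentiable one_ne_zero) hx,
      fderiv_sub (hdiff _ x) (hdiff _ x)]

lemma exists_contDiff_of_isMollification {E : Set V} (hE : E.Nonempty) {f : V → ℝ} {s B : ℝ}
    (hs : 1 < s) (hB : 0 ≤ B) (hA : 0 ≤ A) (hg : ∀ x, ∀ y ∈ E, |g x - f y| ≤ B * dist x y ^ s)
    {Φ χ : ℕ → V → ℝ} (hΦ : ∀ n, IsMollification A ((1 / 2) ^ n) g (Φ n))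
    (hχ : ∀ n, IsCutoff A ((1 / 2) ^ n) E (χ n)) :
    ∃ F : V → ℝ, ContDiff ℝ 1 F ∧ (∀ x ∈ E, F x = f x) ∧ ∀ x ∈ E, fderiv ℝ F x = 0 := by
  have hs0 : 0 ≤ s := by linarith
  set q : ℝ := (1 / 2) ^ (s - 1)
  have hq : Summable fun n : ℕ => B * 4 ^ s * q ^ n := (summable_geometric_of_lt_one
    (by positivity) (Real.rpow_lt_one (by norm_num) (by norm_num) (by linarith))).mul_left _
  set K : ℕ → ℝ := fun n => B * (4 * (1 / 2) ^ n) ^ s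
  have hK_nonneg : ∀ n, 0 ≤ K n := fun n => by positivity
  have hK_div : ∀ n, K n / (1 / 2) ^ n = B * 4 ^ s * q ^ n := fun n => by
    rw [div_eq_iff (by positivity), ← mul_four_mul_two_inv_pow_rpow]
  have hK_sum : Summable K := hq.of_nonneg_of_le hK_nonneg fun n =>
    (hK_div n).symm ▸ le_div_self (hK_nonneg n) (by positivity)
      (pow_le_one₀ (by norm_num) (by norm_num))
  have hself : ∀ n, ∀ x ∈ E, |Φ n x - f x| ≤ K n ∧ ‖fderiv ℝ (Φ n) x‖ ≤ A * K n / (1 / 2) ^ n :=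
    fun n x hx => (hΦ n).abs_sub_le_of_dist_le hs0 hB le_rfl (hg · x hx)
      (by rw [dist_self]; positivity)
  refine exists_contDiff_of_isCutoff (a := fun n => 2 * K n)
    (b := fun n => 3 * A * K n / (1 / 2) ^ n) (fun n => (hΦ n).contDiff) hχ
    (fun n => by positivity) (fun n => by positivity) (hK_sum.mul_left 2)
    ((hq.mul_left (5 * A)).congr fun n => ?_) (fun n x hx => ?_) (fun x hx => ?_) (fun x hx => ?_)
  · rw [← hK_div]
    ring
  · exact (hΦ n).sub_le_of_infDist_lt (by simpa only [pow_succ, mul_one_div] using hΦ (n + 1))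
      hE hs0 hB (by positivity) hg hx
  · exact tendsto_iff_dist_tendsto_zero.2 (squeeze_zero (fun _ => dist_nonneg)
      (fun n => (hself n x hx).1) hK_sum.tendsto_atTop_zero)
  · refine squeeze_zero_norm (fun n => (hself n x hx).2.trans_eq ?_)
      (by simpa only [mul_zero] using hq.tendsto_atTop_zero.const_mul A)
    rw [mul_div_assoc, hK_div]

theorem exists_contDiff_extension_of_holder [FiniteDimensional ℝ V] {E : Set V} {f : V → ℝ}
    {s C : ℝ} (hs : 1 < s) (hC : 0 ≤ C) (hf : ∀ x ∈ E, ∀ y ∈ E, |f x - f y| ≤ C * dist x y ^ s) :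
    ∃ F : V → ℝ, ContDiff ℝ 1 F ∧ (∀ x ∈ E, F x = f x) ∧ ∀ x ∈ E, fderiv ℝ F x = 0 := by
  rcases E.eq_empty_or_nonempty with rfl | hE
  · exact ⟨0, contDiff_const, by simp, by simp⟩
  borelize V
  have hs0 : 0 ≤ s := by linarith
  obtain ⟨g, hgm, B, hB, hg⟩ := exists_measurable_holder_extension hE hs0 hC hf
  obtain ⟨A, hA, hmol⟩ := exists_isMollification V Measure.addHaar
  have hgi : LocallyIntegrable g Measure.addHaar :=
    locallyIntegrable_of_abs_sub_le_dist_rpow hs0 hgm.aestronglyMeasurable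
      (hg · hE.some hE.some_mem)
  have hδ : ∀ n : ℕ, 0 < (1 / 2 : ℝ) ^ n := fun n => by positivity
  choose Φ hΦ using fun n => hmol _ (hδ n) g hgi
  choose χ hχ using fun n => hmol _ (hδ n)
    (indicator {x | Metric.infDist x E < 2 * (1 / 2) ^ n} 1)
    ((locallyIntegrable_const 1).indicator
      (isOpen_lt (Metric.continuous_infDist_pt E) continuous_const).measurableSet)
  exact exists_contDiff_of_isMollification hE hs hB hA hg hΦ fun n => (hχ n).isCutoff (hδ n)

end HolderExtension

/-! ### Arcs with a snowflake parametrization -/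

lemma subarc_subset_subarc {E : Set ℂ} (h e : unitInterval ≃ₜ E) (x y : ℂ) :
    subarc h x y ⊆ subarc e x y := by
  rintro w ⟨a, b, c, rfl, rfl, hc, rfl⟩
  let φ := h.trans e.symm
  have hφ : ∀ t, (e (φ t) : ℂ) = h t := fun t => by simp [φ]
  refine ⟨φ a, φ b, φ c, hφ a, hφ b, ?_, hφ c⟩
  rcases φ.continuous.strictMono_of_inj φ.injective with hmono | hanti
  · exact hmono.monotone.mapsTo_uIcc hc
  · exact hanti.antitone.mapsTo_uIcc hc

lemma subarc_eq_subarc {E : Set ℂ} (h e : unitInterval ≃ₜ E) (x y : ℂ) :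
    subarc h x y = subarc e x y :=
  (subarc_subset_subarc h e x y).antisymm (subarc_subset_subarc e h x y)

lemma rpow_le_rpow_sub_one_mul {d D t : ℝ} (hd : 0 ≤ d) (hdD : d ≤ D) (ht : 1 ≤ t) :
    d ^ t ≤ D ^ (t - 1) * d := by
  calc d ^ t = d ^ (t - 1) * d := by
        rw [← Real.rpow_add_one' hd (by linarith), sub_add_cancel]
    _ ≤ D ^ (t - 1) * d :=
        mul_le_mul_of_nonneg_right (Real.rpow_le_rpow hd hdD (by linarith)) hd

namespace IsSnowflakeParametrization

section MetricSpace

variable {X : Type*} [MetricSpace X] {s c C : ℝ} {γ : ℝ → X} {E : Set X}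

lemma exponent_pos (hγ : IsSnowflakeParametrization s c C γ E) : 0 < s :=
  zero_lt_one.trans hγ.one_lt

lemma upper_const_pos (hγ : IsSnowflakeParametrization s c C γ E) : 0 < C := by
  have hlower := hγ.lower 1 ⟨zero_le_one, le_rfl⟩ 0 ⟨le_rfl, zero_le_one⟩
  have hupper := hγ.upper 1 ⟨zero_le_one, le_rfl⟩ 0 ⟨le_rfl, zero_le_one⟩
  rw [sub_zero, abs_one, mul_one] at hlower hupper
  exact hγ.c_pos.trans_le (hlower.trans hupper)

lemma abs_sub_le (hγ : IsSnowflakeParametrization s c C γ E) {a b : ℝ} (ha : a ∈ Icc (0 : ℝ) 1)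
    (hb : b ∈ Icc (0 : ℝ) 1) : |a - b| ≤ c⁻¹ * dist (γ a) (γ b) ^ s := by
  rw [le_inv_mul_iff₀ hγ.c_pos]
  exact hγ.lower a ha b hb

lemma injOn (hγ : IsSnowflakeParametrization s c C γ E) : InjOn γ (Icc 0 1) := by
  intro a ha b hb hab
  have hle := hγ.abs_sub_le ha hb
  rw [hab, dist_self, Real.zero_rpow hγ.exponent_pos.ne', mul_zero] at hle
  exact sub_eq_zero.1 (abs_nonpos_iff.1 hle)

lemma holderOnWith (hγ : IsSnowflakeParametrization s c C γ E) :
    HolderOnWith (Real.toNNReal (C ^ (1 / s))) (Real.toNNReal (1 / s)) γ (Icc 0 1) :=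
  holderOnWith_of_dist_rpow_le hγ.exponent_pos hγ.upper_const_pos.le hγ.upper

lemma holderOnWith_invFunOn (hγ : IsSnowflakeParametrization s c C γ E) :
    HolderOnWith (Real.toNNReal c⁻¹) (Real.toNNReal s) (Function.invFunOn γ (Icc (0 : ℝ) 1))
      (γ '' Icc 0 1) := by
  refine holderOnWith_of_dist_le (inv_nonneg.2 hγ.c_pos.le) hγ.exponent_pos.le ?_
  rintro _ ⟨a, ha, rfl⟩ _ ⟨b, hb, rfl⟩
  rw [hγ.injOn.leftInvOn_invFunOn ha, hγ.injOn.leftInvOn_invFunOn hb]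
  exact hγ.abs_sub_le ha hb

lemma continuousOn (hγ : IsSnowflakeParametrization s c C γ E) : ContinuousOn γ (Icc 0 1) :=
  hγ.holderOnWith.continuousOn (Real.toNNReal_pos.2 (one_div_pos.2 hγ.exponent_pos))

lemma isCompact (hγ : IsSnowflakeParametrization s c C γ E) : IsCompact E :=
  hγ.image_eq ▸ isCompact_Icc.image_of_continuousOn hγ.continuousOn

lemma image_subset (hγ : IsSnowflakeParametrization s c C γ E) {A : Set ℝ} (hA : A ⊆ Icc 0 1) :
    γ '' A ⊆ E :=
  hγ.image_eq ▸ image_mono hA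

lemma exists_eq (hγ : IsSnowflakeParametrization s c C γ E) {x : X} (hx : x ∈ E) :
    ∃ a ∈ Icc (0 : ℝ) 1, γ a = x := by
  rwa [← hγ.image_eq] at hx

lemma exists_homeomorph (hγ : IsSnowflakeParametrization s c C γ E) :
    ∃ e : unitInterval ≃ₜ E, ∀ t, (e t : X) = γ t := by
  have hmem : ∀ t : unitInterval, γ t ∈ E := fun t => hγ.image_eq ▸ mem_image_of_mem γ t.2
  let g : unitInterval → E := fun t => ⟨γ t, hmem t⟩
  have hg : Continuous g :=
    (continuousOn_iff_continuous_domRestrict.1 hγ.continuousOn).subtype_mk _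
  have hbij : Function.Bijective g := by
    refine ⟨fun a b hab => Subtype.ext (hγ.injOn a.2 b.2 (congrArg Subtype.val hab)), ?_⟩
    rintro ⟨x, hx⟩
    obtain ⟨t, ht, rfl⟩ := hγ.exists_eq hx
    exact ⟨⟨t, ht⟩, rfl⟩
  exact ⟨Continuous.homeoOfEquivCompactToT2 (f := Equiv.ofBijective g hbij) hg, fun _ => rfl⟩

lemma diam_image_uIcc_le (hγ : IsSnowflakeParametrization s c C γ E) {a b : ℝ}
    (ha : a ∈ Icc (0 : ℝ) 1) (hb : b ∈ Icc (0 : ℝ) 1) :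
    Metric.diam (γ '' uIcc a b) ≤ (C / c) ^ (1 / s) * dist (γ a) (γ b) := by
  have hs := hγ.exponent_pos
  have hC := hγ.upper_const_pos
  have hc := hγ.c_pos
  have hsub : uIcc a b ⊆ Icc 0 1 := uIcc_subset_Icc ha hb
  refine Metric.diam_le_of_forall_dist_le (by positivity) ?_
  rintro _ ⟨u, hu, rfl⟩ _ ⟨v, hv, rfl⟩
  have huv : |u - v| ≤ |a - b| := by
    rw [abs_sub_comm a b]
    exact abs_sub_le_of_uIcc_subset_uIcc (uIcc_subset_uIcc hv hu)
  have hdist : dist (γ u) (γ v) ^ s ≤ C / c * dist (γ a) (γ b) ^ s :=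
    calc dist (γ u) (γ v) ^ s ≤ C * |u - v| := hγ.upper u (hsub hu) v (hsub hv)
      _ ≤ C * (c⁻¹ * dist (γ a) (γ b) ^ s) :=
        mul_le_mul_of_nonneg_left (huv.trans (hγ.abs_sub_le ha hb)) hC.le
      _ = C / c * dist (γ a) (γ b) ^ s := by ring
  have := dist_le_of_dist_rpow_le hs (by positivity) (Real.rpow_nonneg dist_nonneg s) hdist
  rwa [← Real.rpow_mul dist_nonneg, mul_one_div_cancel hs.ne', Real.rpow_one] at this

variable [MeasurableSpace X] [BorelSpace X] {a b : ℝ}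

lemma hausdorffMeasure_image_Icc_le (hγ : IsSnowflakeParametrization s c C γ E) (ha : 0 ≤ a)
    (hb : b ≤ 1) : μH[s] (γ '' Icc a b) ≤ ENNReal.ofReal (C * (b - a)) := by
  have hs := hγ.exponent_pos
  have hC := hγ.upper_const_pos
  have hle := (hγ.holderOnWith.mono (Icc_subset_Icc ha hb)).hausdorffMeasure_image_le
    (Real.toNNReal_pos.2 (one_div_pos.2 hs)) hs.le
  refine hle.trans_eq ?_
  rw [Real.coe_toNNReal _ (by positivity), one_div_mul_cancel hs.ne', hausdorffMeasure_real,
    Real.volume_Icc]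
  change ENNReal.ofReal _ ^ s * _ = _
  rw [ENNReal.ofReal_rpow_of_nonneg (by positivity) hs.le, ← Real.rpow_mul hC.le,
    one_div_mul_cancel hs.ne', Real.rpow_one, ← ENNReal.ofReal_mul hC.le]

lemma hausdorffMeasure_image_Ioc_pos (hγ : IsSnowflakeParametrization s c C γ E) (ha : 0 ≤ a)
    (hab : a < b) (hb : b ≤ 1) : 0 < μH[s] (γ '' Ioc a b) := by
  have hs := hγ.exponent_pos
  have hsub : Ioc a b ⊆ Icc 0 1 := fun t ht => ⟨ha.trans ht.1.le, ht.2.trans hb⟩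
  have hle := (hγ.holderOnWith_invFunOn.mono (image_mono hsub)).hausdorffMeasure_image_le
    (Real.toNNReal_pos.2 hs) zero_le_one
  rw [(hγ.injOn.leftInvOn_invFunOn).image_image' hsub, Real.coe_toNNReal _ hs.le, mul_one,
    hausdorffMeasure_real, Real.volume_Ioc] at hle
  refine pos_iff_ne_zero.2 fun hzero => ?_
  rw [hzero, mul_zero, nonpos_iff_eq_zero, ENNReal.ofReal_eq_zero] at hle
  linarith

lemma hausdorffMeasure_ne_top (hγ : IsSnowflakeParametrization s c C γ E) : μH[s] E ≠ ⊤ := by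
  rw [← hγ.image_eq]
  exact ((hγ.hausdorffMeasure_image_Icc_le le_rfl le_rfl).trans_lt ENNReal.ofReal_lt_top).ne

lemma hausdorffMeasure_ne_zero (hγ : IsSnowflakeParametrization s c C γ E) : μH[s] E ≠ 0 :=
  ((hγ.hausdorffMeasure_image_Ioc_pos le_rfl zero_lt_one le_rfl).trans_le
    (measure_mono (hγ.image_subset Ioc_subset_Icc_self))).ne'

omit [MeasurableSpace X] [BorelSpace X] in
lemma toReal_dimH_eq (hγ : IsSnowflakeParametrization s c C γ E) : (dimH E).toReal = s := by
  borelize X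
  have hs : ((Real.toNNReal s : NNReal) : ℝ) = s := Real.coe_toNNReal _ hγ.exponent_pos.le
  rw [dimH_of_hausdorffMeasure_ne_zero_ne_top (d := Real.toNNReal s)
    (by rw [hs]; exact hγ.hausdorffMeasure_ne_zero) (by rw [hs]; exact hγ.hausdorffMeasure_ne_top),
    ENNReal.coe_toReal, hs]

lemma hausdorffMeasure_image_Icc_sub (hγ : IsSnowflakeParametrization s c C γ E) (ha : 0 ≤ a)
    (hab : a ≤ b) (hb : b ≤ 1) :
    (μH[s] (γ '' Icc 0 b)).toReal - (μH[s] (γ '' Icc 0 a)).toReal =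
      (μH[s] (γ '' Ioc a b)).toReal := by
  have hIcc : Icc 0 a ⊆ Icc (0 : ℝ) 1 := Icc_subset_Icc le_rfl (hab.trans hb)
  have hIoc : Ioc a b ⊆ Icc (0 : ℝ) 1 := fun t ht => ⟨ha.trans ht.1.le, ht.2.trans hb⟩
  have hfin : ∀ A ⊆ Icc (0 : ℝ) 1, μH[s] (γ '' A) ≠ ⊤ := fun A hA =>
    ne_top_of_le_ne_top hγ.hausdorffMeasure_ne_top (measure_mono (hγ.image_subset hA))
  have hdisj : Disjoint (γ '' Icc 0 a) (γ '' Ioc a b) :=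
    disjoint_image_image fun u hu v hv huv =>
      (hu.2.trans_lt hv.1).ne (hγ.injOn (hIcc hu) (hIoc hv) huv)
  have hmeas : MeasurableSet (γ '' Icc 0 a) :=
    (isCompact_Icc.image_of_continuousOn (hγ.continuousOn.mono hIcc)).measurableSet
  rw [← Icc_union_Ioc_eq_Icc ha hab, image_union, measure_union' hdisj hmeas,
    ENNReal.toReal_add (hfin _ hIcc) (hfin _ hIoc), add_sub_cancel_left]

lemma hausdorffMeasure_image_Icc_sub_pos (hγ : IsSnowflakeParametrization s c C γ E) (ha : 0 ≤ a)
    (hab : a < b) (hb : b ≤ 1) :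
    0 < (μH[s] (γ '' Icc 0 b)).toReal - (μH[s] (γ '' Icc 0 a)).toReal := by
  rw [hγ.hausdorffMeasure_image_Icc_sub ha hab.le hb]
  exact ENNReal.toReal_pos (hγ.hausdorffMeasure_image_Ioc_pos ha hab hb).ne'
    (ne_top_of_le_ne_top hγ.hausdorffMeasure_ne_top
      (measure_mono (hγ.image_subset fun t ht => ⟨ha.trans ht.1.le, ht.2.trans hb⟩)))

lemma hausdorffMeasure_image_Icc_sub_le (hγ : IsSnowflakeParametrization s c C γ E) (ha : 0 ≤ a)
    (hab : a ≤ b) (hb : b ≤ 1) :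
    (μH[s] (γ '' Icc 0 b)).toReal - (μH[s] (γ '' Icc 0 a)).toReal ≤ C * (b - a) := by
  rw [hγ.hausdorffMeasure_image_Icc_sub ha hab hb]
  exact ENNReal.toReal_le_of_le_ofReal (mul_nonneg hγ.upper_const_pos.le (sub_nonneg.2 hab))
    ((measure_mono (image_mono Ioc_subset_Icc_self)).trans
      (hγ.hausdorffMeasure_image_Icc_le ha hb))

end MetricSpace

section Plane

variable {s c C : ℝ} {γ : ℝ → ℂ} {E : Set ℂ}

lemma subarc_eq_image (hγ : IsSnowflakeParametrization s c C γ E) (h : unitInterval ≃ₜ E)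
    {a b : ℝ} (ha : a ∈ Icc (0 : ℝ) 1) (hb : b ∈ Icc (0 : ℝ) 1) :
    subarc h (γ a) (γ b) = γ '' uIcc a b := by
  obtain ⟨e, he⟩ := hγ.exists_homeomorph
  rw [subarc_eq_subarc h e]
  ext w
  constructor
  · rintro ⟨a', b', c', hγa, hγb, hc', rfl⟩
    rw [he] at hγa hγb
    rw [← hγ.injOn a'.2 ha hγa, ← hγ.injOn b'.2 hb hγb, he]
    exact mem_image_of_mem γ (mem_uIcc.2 (mem_uIcc.1 hc'))
  · rintro ⟨t, ht, rfl⟩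
    exact ⟨⟨a, ha⟩, ⟨b, hb⟩, ⟨t, uIcc_subset_Icc ha hb ht⟩, he _, he _,
      mem_uIcc.2 (mem_uIcc.1 ht), he _⟩

theorem isTQuasiArc (hγ : IsSnowflakeParametrization s c C γ E) {t : ℝ} (ht : 1 ≤ t) :
    IsTQuasiArc t E := by
  have hC := hγ.upper_const_pos
  have hc := hγ.c_pos
  obtain ⟨e, -⟩ := hγ.exists_homeomorph
  set D : ℝ := Metric.diam E + 1
  refine ⟨ht, e, D ^ (t - 1) * (C / c) ^ (1 / s), by positivity, fun x hx y hy => ?_⟩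
  obtain ⟨a, ha, rfl⟩ := hγ.exists_eq hx
  obtain ⟨b, hb, rfl⟩ := hγ.exists_eq hy
  rw [hγ.subarc_eq_image e ha hb]
  have hdiam : Metric.diam (γ '' uIcc a b) ≤ D := by
    linarith [Metric.diam_mono (hγ.image_subset (uIcc_subset_Icc ha hb)) hγ.isCompact.isBounded]
  calc Metric.diam (γ '' uIcc a b) ^ t
      ≤ D ^ (t - 1) * Metric.diam (γ '' uIcc a b) :=
        rpow_le_rpow_sub_one_mul Metric.diam_nonneg hdiam ht
    _ ≤ D ^ (t - 1) * ((C / c) ^ (1 / s) * dist (γ a) (γ b)) :=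
        mul_le_mul_of_nonneg_left (hγ.diam_image_uIcc_le ha hb) (by positivity)
    _ = D ^ (t - 1) * (C / c) ^ (1 / s) * dist (γ a) (γ b) := by ring

lemma hausdorffMeasure_subarc (hγ : IsSnowflakeParametrization s c C γ E) (h : unitInterval ≃ₜ E)
    {t : ℝ} (ht : t ∈ Icc (0 : ℝ) 1) :
    (μH[s] (subarc h (γ 0) (γ t))).toReal = (μH[s] (γ '' Icc 0 t)).toReal := by
  rw [hγ.subarc_eq_image h ⟨le_rfl, zero_le_one⟩ ht, uIcc_of_le ht.1]

lemma abs_hausdorffMeasure_subarc_sub_le (hγ : IsSnowflakeParametrization s c C γ E)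
    (h : unitInterval ≃ₜ E) : ∀ x ∈ E, ∀ y ∈ E,
      |(μH[s] (subarc h (γ 0) x)).toReal - (μH[s] (subarc h (γ 0) y)).toReal| ≤
        C / c * dist x y ^ s := by
  intro x hx y hy
  obtain ⟨a, ha, rfl⟩ := hγ.exists_eq hx
  obtain ⟨b, hb, rfl⟩ := hγ.exists_eq hy
  wlog hab : a ≤ b generalizing a b
  · rw [abs_sub_comm, dist_comm]
    exact this b hb hy a ha hx (le_of_not_ge hab)
  rcases hab.eq_or_lt with rfl | hlt
  · rw [sub_self, abs_zero, dist_self, Real.zero_rpow hγ.exponent_pos.ne', mul_zero]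
  · rw [hγ.hausdorffMeasure_subarc h ha, hγ.hausdorffMeasure_subarc h hb, abs_sub_comm,
      abs_of_pos (hγ.hausdorffMeasure_image_Icc_sub_pos ha.1 hlt hb.2)]
    calc _ ≤ C * (b - a) := hγ.hausdorffMeasure_image_Icc_sub_le ha.1 hab hb.2
      _ ≤ C * (c⁻¹ * dist (γ a) (γ b) ^ s) := by
          refine mul_le_mul_of_nonneg_left ?_ hγ.upper_const_pos.le
          rw [← abs_of_pos (sub_pos.2 hlt), abs_sub_comm]
          exact hγ.abs_sub_le ha hb
      _ = C / c * dist (γ a) (γ b) ^ s := by ring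

theorem isStrictWhitneyFunctionOn (hγ : IsSnowflakeParametrization s c C γ E)
    (h : unitInterval ≃ₜ E) :
    IsStrictWhitneyFunctionOn E (hausdorffMeasureFunction h s (γ 0)) := by
  obtain ⟨e, he⟩ := hγ.exists_homeomorph
  obtain ⟨F, hF, hFE, hdF⟩ := exists_contDiff_extension_of_holder hγ.one_lt
    (div_nonneg hγ.upper_const_pos.le hγ.c_pos.le) (hγ.abs_hausdorffMeasure_subarc_sub_le h)
  have hmono : StrictMono fun t => hausdorffMeasureFunction h s (γ 0) (e t) := by
    intro a b hab
    simp only [hausdorffMeasureFunction, he]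
    rw [hγ.hausdorffMeasure_subarc h a.2, hγ.hausdorffMeasure_subarc h b.2, ← sub_pos]
    exact hγ.hausdorffMeasure_image_Icc_sub_pos a.2.1 hab b.2.2
  refine ⟨⟨?_, ⟨F, hF, hdF, fun x => hFE x x.2⟩, e 0, e 1, (hmono zero_lt_one).ne⟩, ?_⟩
  · rw [← hγ.image_eq]
    exact (isConnected_Icc zero_le_one).image γ hγ.continuousOn
  · intro U hU hUne
    obtain ⟨t, ht⟩ := hUne.preimage e.surjective
    obtain ⟨a, ha, b, hb, hab⟩ :=
      (infinite_of_mem_nhds t ((hU.preimage e.continuous).mem_nhds ht)).nontrivial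
    exact ⟨e a, ha, e b, hb, hmono.injective.ne hab⟩

end Plane

end IsSnowflakeParametrization

/-! ### Chains of intervals -/

section IntervalChains

variable {α : Type*} {n i j : ℕ} {a b : ℕ → α}

section LinearOrder

variable [LinearOrder α]

lemma right_eq_left_succ_of_chain (hab : ∀ k < n, a k < b k)
    (hno : ∀ i < n, ∀ j < n, i ≠ j → b i ≤ a j ∨ b j ≤ a i)
    (hadj : ∀ k, k + 1 < n → b k = a (k + 1) ∨ b (k + 1) = a k) (h0 : b 0 = a 1) :
    ∀ k, k + 1 < n → b k = a (k + 1)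
  | 0, _ => h0
  | k + 1, hk => by
    have ih := right_eq_left_succ_of_chain hab hno hadj h0 k (by omega)
    refine (hadj (k + 1) hk).resolve_right fun hback => ?_
    have hbb : b (k + 2) = b k := hback.trans ih.symm
    rcases hno k (by omega) (k + 2) hk (by omega) with hle | hle
    · exact (hbb ▸ hle).not_gt (hab (k + 2) hk)
    · exact (hbb ▸ hle).not_gt (hab k (by omega))

lemma right_lt_left_of_chain (hab : ∀ k < n, a k < b k)
    (hsucc : ∀ k, k + 1 < n → b k = a (k + 1)) (hij : i + 1 < j) (hj : j < n) : b i < a j := by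
  induction j, hij using Nat.le_induction with
  | base =>
    rw [hsucc i (by omega), ← hsucc (i + 1) hj]
    exact hab (i + 1) (by omega)
  | succ j _ ih =>
    rw [← hsucc j hj]
    exact (ih (by omega)).trans (hab j (by omega))

lemma disjoint_Icc_of_chain (hab : ∀ k < n, a k < b k)
    (hno : ∀ i < n, ∀ j < n, i ≠ j → b i ≤ a j ∨ b j ≤ a i)
    (hmeet : ∀ k, k + 1 < n → (Icc (a k) (b k) ∩ Icc (a (k + 1)) (b (k + 1))).Nonempty)
    (hij : i + 1 < j) (hj : j < n) : Disjoint (Icc (a i) (b i)) (Icc (a j) (b j)) := by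
  have hadj : ∀ k, k + 1 < n → b k = a (k + 1) ∨ b (k + 1) = a k := by
    intro k hk
    obtain ⟨c, ⟨hac, hcb⟩, hac', hcb'⟩ := hmeet k hk
    exact (hno k (by omega) (k + 1) hk (by omega)).imp
      (fun hle => hle.antisymm (hac'.trans hcb)) (fun hle => hle.antisymm (hac.trans hcb'))
  rcases hadj 0 (by omega) with h0 | h0
  · have hlt := right_lt_left_of_chain hab (right_eq_left_succ_of_chain hab hno hadj h0) hij hj
    exact disjoint_left.2 fun x hx hx' => (hx'.1.trans hx.2).not_gt hlt
  · -- The chain runs to the left: reverse the order.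
    have hsucc := right_eq_left_succ_of_chain (α := αᵒᵈ) (a := b) (b := a) hab
      (fun i hi j hj hij => (hno i hi j hj hij).symm)
      (fun k hk => (hadj k hk).symm.imp Eq.symm Eq.symm) h0.symm
    have hlt : b j < a i := right_lt_left_of_chain (α := αᵒᵈ) (a := b) (b := a) hab hsucc hij hj
    exact disjoint_left.2 fun x hx hx' => (hx.1.trans hx'.2).not_gt hlt

end LinearOrder

variable [ConditionallyCompleteLinearOrder α] [DenselyOrdered α] [TopologicalSpace α]
  [OrderTopology α]

lemma disjoint_of_chain_of_isConnected {P : ℕ → Set α} (hconn : ∀ k < n, IsConnected (P k))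
    (hcomp : ∀ k < n, IsCompact (P k)) (hnontriv : ∀ k < n, (P k).Nontrivial)
    (hno : ∀ i < n, ∀ j < n, i ≠ j → interior (P i ∩ P j) = ∅)
    (hmeet : ∀ k, k + 1 < n → (P k ∩ P (k + 1)).Nonempty) (hij : i + 1 < j) (hj : j < n) :
    Disjoint (P i) (P j) := by
  have hIcc : ∀ k < n, P k = Icc (sInf (P k)) (sSup (P k)) := fun k hk =>
    eq_Icc_of_connected_compact (hconn k hk) (hcomp k hk)
  have hlt : ∀ k < n, sInf (P k) < sSup (P k) := fun k hk => by
    have := hnontriv k hk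
    rw [hIcc k hk] at this
    exact lt_of_not_ge fun hle => this.not_subsingleton (subsingleton_Icc_of_ge hle)
  rw [hIcc i (by omega), hIcc j hj]
  refine disjoint_Icc_of_chain hlt (fun k hk m hm hkm => ?_) (fun k hk => ?_) hij hj
  · by_contra! hoverlap
    have hsub : Ioo (sInf (P k) ⊔ sInf (P m)) (sSup (P k) ⊓ sSup (P m)) ⊆ P k ∩ P m := by
      rw [hIcc k hk, hIcc m hm, Icc_inter_Icc, ← hIcc k hk, ← hIcc m hm]
      exact Ioo_subset_Icc_self
    have hempty := subset_empty_iff.1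
      ((interior_maximal hsub isOpen_Ioo).trans (hno k hk m hm hkm).subset)
    exact (nonempty_Ioo.2 (max_lt (lt_min (hlt k hk) hoverlap.2)
      (lt_min hoverlap.1 (hlt m hm)))).ne_empty hempty
  · rw [← hIcc k (by omega), ← hIcc (k + 1) hk]
    exact hmeet k hk

lemma disjoint_of_chain_of_homeomorph {Y : Type*} [TopologicalSpace Y] (e : α ≃ₜ Y)
    {B : ℕ → Set Y} (hconn : ∀ k < n, IsConnected (B k)) (hcomp : ∀ k < n, IsCompact (B k))
    (hnontriv : ∀ k < n, (B k).Nontrivial)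
    (hno : ∀ i < n, ∀ j < n, i ≠ j → interior (B i ∩ B j) = ∅)
    (hmeet : ∀ k, k + 1 < n → (B k ∩ B (k + 1)).Nonempty) (hij : i + 1 < j) (hj : j < n) :
    Disjoint (B i) (B j) := by
  refine Disjoint.of_preimage e.surjective ?_
  refine disjoint_of_chain_of_isConnected (P := fun k => e ⁻¹' B k)
    (fun k hk => e.isConnected_preimage.2 (hconn k hk))
    (fun k hk => e.isCompact_preimage.2 (hcomp k hk))
    (fun k hk => (hnontriv k hk).preimage e.surjective) (fun i hi j hj hne => ?_)
    (fun k hk => (hmeet k hk).preimage e.surjective) hij hj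
  rw [← preimage_inter, ← e.preimage_interior, hno i hi j hj hne, preimage_empty]

end IntervalChains

/-! ### Plane sectors -/

section Cones

variable {V : Type*} {p₁ p₂ q₁ q₂ : V} {x y x' y' : ℝ}

lemma eventually_pos_add_mul {x m : ℝ} (hx : 0 ≤ x) (hm : x = 0 → 0 < m) :
    ∀ᶠ ε in 𝓝[>] (0 : ℝ), 0 < x + ε * m := by
  rcases hx.eq_or_lt with rfl | hx
  · filter_upwards [self_mem_nhdsWithin] with ε hε
    rw [zero_add]
    exact mul_pos hε (hm rfl)
  · have hcont : ContinuousAt (fun ε => x + ε * m) 0 := by fun_prop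
    exact nhdsWithin_le_nhds (hcont.eventually (lt_mem_nhds (by simpa using hx)))

-- Moving the common point along the common direction brings it into both open cones.
lemma exists_mem_openCones [AddCommGroup V] [Module ℝ V] {m₁ m₂ n₁ n₂ : ℝ} (hx : 0 ≤ x)
    (hy : 0 ≤ y) (hx' : 0 ≤ x') (hy' : 0 ≤ y') (hpoint : x • p₁ + y • p₂ = x' • q₁ + y' • q₂)
    (hdir : m₁ • p₁ + m₂ • p₂ = n₁ • q₁ + n₂ • q₂) (hm₁ : x = 0 → 0 < m₁)
    (hm₂ : y = 0 → 0 < m₂) (hn₁ : x' = 0 → 0 < n₁) (hn₂ : y' = 0 → 0 < n₂) :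
    ∃ a b a' b' : ℝ, 0 < a ∧ 0 < b ∧ 0 < a' ∧ 0 < b' ∧
      a • p₁ + b • p₂ = a' • q₁ + b' • q₂ := by
  obtain ⟨ε, h₁, h₂, h₃, h₄⟩ := ((eventually_pos_add_mul hx hm₁).and
    ((eventually_pos_add_mul hy hm₂).and ((eventually_pos_add_mul hx' hn₁).and
      (eventually_pos_add_mul hy' hn₂)))).exists
  exact ⟨_, _, _, _, h₁, h₂, h₃, h₄, by linear_combination (norm := module) hpoint + ε • hdir⟩

lemma exists_mul_sum_le_norm {ι : Type*} [Fintype ι] [NormedAddCommGroup V] [NormedSpace ℝ V]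
    {v : ι → V} (hv : ∀ x : ι → ℝ, (∀ i, 0 ≤ x i) → ∑ i, x i • v i = 0 → x = 0) :
    ∃ m > 0, ∀ x : ι → ℝ, (∀ i, 0 ≤ x i) → m * ∑ i, x i ≤ ‖∑ i, x i • v i‖ := by
  obtain ⟨m, hm, hle⟩ := (isCompact_stdSimplex ℝ ι).exists_forall_le'
    (f := fun x => ‖∑ i, x i • v i‖) (a := 0) (by fun_prop) (by
      intro x hx
      refine norm_pos_iff.2 fun hzero => ?_
      have := hx.2
      simp [hv x hx.1 hzero] at this)
  refine ⟨m, hm, fun x hx => ?_⟩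
  set S := ∑ i, x i with hS
  have hS_nonneg : 0 ≤ S := Finset.sum_nonneg fun i _ => hx i
  rcases hS_nonneg.eq_or_lt with hS0 | hS0
  · rw [← hS0, mul_zero]
    exact norm_nonneg _
  · have hmem : S⁻¹ • x ∈ stdSimplex ℝ ι := by
      refine ⟨fun i => mul_nonneg (inv_nonneg.2 hS0.le) (hx i), ?_⟩
      simp only [Pi.smul_apply, smul_eq_mul, ← Finset.mul_sum, ← hS, inv_mul_cancel₀ hS0.ne']
    have := hle _ hmem
    simp only [Pi.smul_apply, smul_assoc, ← Finset.smul_sum, norm_smul, norm_inv,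
      Real.norm_of_nonneg hS0.le] at this
    rwa [le_inv_mul_iff₀ hS0, mul_comm] at this

lemma exists_norm_le_mul_norm_sub_of_cones [NormedAddCommGroup V] [NormedSpace ℝ V]
    (hinter : ∀ x y x' y' : ℝ, 0 ≤ x → 0 ≤ y → 0 ≤ x' → 0 ≤ y' →
      x • p₁ + y • p₂ = x' • q₁ + y' • q₂ → x = 0 ∧ y = 0 ∧ x' = 0 ∧ y' = 0) :
    ∃ K : ℝ, 0 ≤ K ∧ ∀ x y x' y' : ℝ, 0 ≤ x → 0 ≤ y → 0 ≤ x' → 0 ≤ y' →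
      ‖x • p₁ + y • p₂‖ ≤ K * ‖(x • p₁ + y • p₂) - (x' • q₁ + y' • q₂)‖ := by
  obtain ⟨m, hm, hle⟩ := exists_mul_sum_le_norm (v := ![p₁, p₂, -q₁, -q₂]) (by
    intro x hx hzero
    simp only [Fin.sum_univ_four, Matrix.cons_val, smul_neg] at hzero
    obtain ⟨h₀, h₁, h₂, h₃⟩ := hinter _ _ _ _ (hx 0) (hx 1) (hx 2) (hx 3)
      (by linear_combination (norm := module) hzero)
    ext i
    fin_cases i <;> assumption)
  set M : ℝ := ‖p₁‖ + ‖p₂‖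
  refine ⟨M / m, by positivity, fun x y x' y' hx hy hx' hy' => ?_⟩
  have hmain := hle ![x, y, x', y'] (by intro i; fin_cases i <;> assumption)
  simp only [Fin.sum_univ_four, Matrix.cons_val, smul_neg] at hmain
  calc ‖x • p₁ + y • p₂‖ ≤ x * ‖p₁‖ + y * ‖p₂‖ := by
        refine (norm_add_le _ _).trans_eq ?_
        rw [norm_smul_of_nonneg hx, norm_smul_of_nonneg hy]
    _ ≤ M * (x + y + x' + y') := by
        nlinarith [norm_nonneg p₁, norm_nonneg p₂]
    _ = M / m * (m * (x + y + x' + y')) := by field_simp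
    _ ≤ M / m * ‖(x • p₁ + y • p₂) - (x' • q₁ + y' • q₂)‖ := by
        refine mul_le_mul_of_nonneg_left (hmain.trans_eq ?_) (by positivity)
        congr 1
        abel

end Cones

attribute [local instance] Complex.finrank_real_complex_fact

local notation "ω" => Complex.orientation.areaForm

section AreaForm

variable {p₁ p₂ q₁ q₂ : ℂ} {x y x' y' : ℝ}

lemma areaForm_mul_mul (c u v : ℂ) : ω (c * u) (c * v) = ‖c‖ ^ 2 * ω u v := by
  rw [Complex.areaForm, Complex.areaForm, map_mul, mul_mul_mul_comm, mul_comm _ c,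
    Complex.mul_conj', ← Complex.ofReal_pow, Complex.im_ofReal_mul]

lemma areaForm_smul_eq (u v w : ℂ) : ω u v • w = ω w v • u + ω u w • v := by
  simp only [Complex.areaForm]
  apply Complex.ext <;> simp <;> ring

lemma eq_smul_add_smul_of_areaForm_ne_zero {u v : ℂ} (huv : ω u v ≠ 0) (w : ℂ) :
    w = (ω w v / ω u v) • u + (ω u w / ω u v) • v := by
  rw [div_eq_inv_mul, div_eq_inv_mul, mul_smul, mul_smul, ← smul_add, ← areaForm_smul_eq,
    inv_smul_smul₀ huv]

lemma add_smul_ne_of_disjoint_cones (hp : ω p₁ p₂ ≠ 0)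
    (hdisj : ∀ x y x' y' : ℝ, 0 < x → 0 < y → 0 < x' → 0 < y' →
      x • p₁ + y • p₂ ≠ x' • q₁ + y' • q₂)
    (hx : 0 < x) (hy : 0 < y) (hx' : 0 ≤ x') (hy' : 0 ≤ y') :
    x • p₁ + y • p₂ ≠ x' • q₁ + y' • q₂ := by
  intro h
  obtain ⟨a, b, a', b', ha, hb, ha', hb', he⟩ := exists_mem_openCones hx.le hy.le hx' hy' h
    ((eq_smul_add_smul_of_areaForm_ne_zero hp ((1 : ℝ) • q₁ + (1 : ℝ) • q₂)).symm)
    (fun h0 => absurd h0 hx.ne') (fun h0 => absurd h0 hy.ne') (fun _ => one_pos) fun _ => one_pos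
  exact hdisj a b a' b' ha hb ha' hb' he

lemma smul_ne_smul_of_disjoint_cones (hpq : ω p₁ p₂ * ω q₁ q₂ < 0)
    (hdisj : ∀ x y x' y' : ℝ, 0 < x → 0 < y → 0 < x' → 0 < y' →
      x • p₁ + y • p₂ ≠ x' • q₁ + y' • q₂) (hx : 0 < x) (hy' : 0 < y') :
    x • p₁ ≠ y' • q₂ := by
  intro h
  have hp : ω p₁ p₂ ≠ 0 := fun h0 => by simp [h0] at hpq
  have hform : x * ω p₁ q₁ = -(y' * ω q₁ q₂) := by
    have := congrArg (fun w => ω w q₁) h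
    simp only [map_smul, LinearMap.smul_apply, smul_eq_mul] at this
    rw [this, Complex.orientation.areaForm_swap q₂ q₁, mul_neg]
  have hm : 0 < ω p₁ q₁ / ω p₁ p₂ := by
    refine div_pos_iff.2 (mul_pos_iff.1 (pos_of_mul_pos_right (a := x) ?_ hx.le))
    linear_combination (exp := 1) (mul_pos hy' (neg_pos.2 hpq)) - ω p₁ p₂ * hform
  have hpoint : x • p₁ + (0 : ℝ) • p₂ = (0 : ℝ) • q₁ + y' • q₂ := by
    rw [zero_smul, zero_smul, add_zero, zero_add, h]
  have hdir : (ω q₁ p₂ / ω p₁ p₂) • p₁ + (ω p₁ q₁ / ω p₁ p₂) • p₂ =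
      (1 : ℝ) • q₁ + (0 : ℝ) • q₂ := by
    rw [← eq_smul_add_smul_of_areaForm_ne_zero hp q₁, one_smul, zero_smul, add_zero]
  obtain ⟨a, b, a', b', ha, hb, ha', hb', he⟩ := exists_mem_openCones hx.le le_rfl le_rfl hy'.le
    hpoint hdir (fun h0 => absurd h0 hx.ne') (fun _ => hm) (fun _ => one_pos)
    fun h0 => absurd h0 hy'.ne'
  exact hdisj a b a' b' ha hb ha' hb' he

lemma eq_zero_of_smul_eq_smul {u v : ℂ} (hu : u ≠ 0) (hv : v ≠ 0)
    (hne : ∀ a b : ℝ, 0 < a → 0 < b → a • u ≠ b • v) (hx : 0 ≤ x) (hy : 0 ≤ y)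
    (h : x • u = y • v) : x = 0 ∧ y = 0 := by
  rcases hx.eq_or_lt with rfl | hx
  · exact ⟨rfl, by simpa [hv] using h⟩
  rcases hy.eq_or_lt with rfl | hy
  · exact ⟨by simpa [hu] using h, rfl⟩
  · exact absurd h (hne x y hx hy)

lemma eq_zero_of_disjoint_cones (hpq : ω p₁ p₂ * ω q₁ q₂ < 0)
    (hdisj : ∀ x y x' y' : ℝ, 0 < x → 0 < y → 0 < x' → 0 < y' →
      x • p₁ + y • p₂ ≠ x' • q₁ + y' • q₂)
    (houter : ∀ x x' : ℝ, 0 < x → 0 < x' → x • p₁ ≠ x' • q₁)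
    (hinner : ∀ y y' : ℝ, 0 < y → 0 < y' → y • p₂ ≠ y' • q₂)
    (hx : 0 ≤ x) (hy : 0 ≤ y) (hx' : 0 ≤ x') (hy' : 0 ≤ y')
    (h : x • p₁ + y • p₂ = x' • q₁ + y' • q₂) : x = 0 ∧ y = 0 ∧ x' = 0 ∧ y' = 0 := by
  have hp : ω p₁ p₂ ≠ 0 := fun h0 => by simp [h0] at hpq
  have hq : ω q₁ q₂ ≠ 0 := fun h0 => by simp [h0] at hpq
  have hp₁ : p₁ ≠ 0 := by rintro rfl; simp at hp
  have hp₂ : p₂ ≠ 0 := by rintro rfl; simp at hp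
  have hq₁ : q₁ ≠ 0 := by rintro rfl; simp at hq
  have hq₂ : q₂ ≠ 0 := by rintro rfl; simp at hq
  have hdisj' : ∀ x y x' y' : ℝ, 0 < x → 0 < y → 0 < x' → 0 < y' →
      x • q₁ + y • q₂ ≠ x' • p₁ + y' • p₂ := fun x y x' y' hx hy hx' hy' he =>
    hdisj x' y' x y hx' hy' hx hy he.symm
  have hxy : x = 0 ∨ y = 0 := by
    by_contra! hne
    exact add_smul_ne_of_disjoint_cones hp hdisj (hx.lt_of_ne' hne.1) (hy.lt_of_ne' hne.2)
      hx' hy' h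
  have hxy' : x' = 0 ∨ y' = 0 := by
    by_contra! hne
    exact add_smul_ne_of_disjoint_cones hq hdisj' (hx'.lt_of_ne' hne.1)
      (hy'.lt_of_ne' hne.2) hx hy h.symm
  rcases hxy with rfl | rfl <;> rcases hxy' with rfl | rfl <;>
    simp only [zero_smul, add_zero, zero_add] at h
  · have := eq_zero_of_smul_eq_smul hp₂ hq₂ hinner hy hy' h
    tauto
  · have := eq_zero_of_smul_eq_smul hq₁ hp₂ (fun a b ha hb =>
      smul_ne_smul_of_disjoint_cones (mul_comm (ω p₁ p₂) _ ▸ hpq) hdisj' ha hb) hx' hy h.symm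
    tauto
  · have := eq_zero_of_smul_eq_smul hp₁ hq₂ (fun a b ha hb =>
      smul_ne_smul_of_disjoint_cones hpq hdisj ha hb) hx hy' h
    tauto
  · have := eq_zero_of_smul_eq_smul hp₁ hq₁ houter hx hx' h
    tauto

end AreaForm

section Triangle

lemma mem_convexHull_triple {E : Type*} [AddCommGroup E] [Module ℝ E] {u v p w : E} :
    w ∈ convexHull ℝ {u, v, p} ↔
      ∃ x y : ℝ, 0 ≤ x ∧ 0 ≤ y ∧ x + y ≤ 1 ∧ u + (x • (v - u) + y • (p - u)) = w := by
  constructor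
  · rw [convexHull_insert (by simp), convexHull_pair, mem_convexJoin]
    simp only [mem_singleton_iff, exists_eq_left, segment_eq_image', mem_image, mem_Icc]
    rintro ⟨_, ⟨b, ⟨hb, hb'⟩, rfl⟩, a, ⟨ha, ha'⟩, rfl⟩
    exact ⟨a * (1 - b), a * b, mul_nonneg ha (sub_nonneg.2 hb'), mul_nonneg ha hb,
      by linarith, by module⟩
  · rintro ⟨x, y, hx, hy, hxy, rfl⟩
    have hsum := (convex_convexHull ℝ {u, v, p}).sum_mem (t := Finset.univ)
      (w := ![1 - x - y, x, y]) (z := ![u, v, p])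
      (by intro i _; fin_cases i <;> simp <;> linarith)
      (by simp [Fin.sum_univ_three]; ring)
      (by intro i _; fin_cases i <;> exact subset_convexHull ℝ _ (by simp))
    convert hsum using 1
    simp only [Fin.sum_univ_three, Matrix.cons_val]
    module

lemma add_smul_mem_interior_convexHull {u v p : ℂ} (huvp : ω (v - u) (p - u) ≠ 0) {x y : ℝ}
    (hx : 0 < x) (hy : 0 < y) (hxy : x + y < 1) :
    u + (x • (v - u) + y • (p - u)) ∈ interior (convexHull ℝ {u, v, p}) := by
  set D := ω (v - u) (p - u)
  let X : ℂ → ℝ := fun w => ω (w - u) (p - u) / D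
  let Y : ℂ → ℝ := fun w => ω (v - u) (w - u) / D
  have hX : Continuous X := by
    simp only [X, Complex.areaForm]
    fun_prop
  have hY : Continuous Y := by
    simp only [Y, Complex.areaForm]
    fun_prop
  have hopen : IsOpen {w | (0 < X w ∧ 0 < Y w) ∧ X w + Y w < 1} :=
    ((isOpen_lt continuous_const hX).inter (isOpen_lt continuous_const hY)).inter
      (isOpen_lt (hX.add hY) continuous_const)
  refine interior_maximal ?_ hopen ?_
  · rintro w ⟨⟨hXw, hYw⟩, hsum⟩
    refine mem_convexHull_triple.2 ⟨X w, Y w, hXw.le, hYw.le, hsum.le, ?_⟩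
    rw [← eq_smul_add_smul_of_areaForm_ne_zero huvp, add_sub_cancel]
  · have hXw : X (u + (x • (v - u) + y • (p - u))) = x := by
      simp only [X, add_sub_cancel_left, map_add, map_smul, LinearMap.add_apply,
        LinearMap.smul_apply, Complex.orientation.areaForm_apply_self, smul_eq_mul, mul_zero,
        add_zero]
      exact mul_div_cancel_right₀ x huvp
    have hYw : Y (u + (x • (v - u) + y • (p - u))) = y := by
      simp only [Y, add_sub_cancel_left, map_add, map_smul,
        Complex.orientation.areaForm_apply_self, smul_eq_mul, mul_zero, zero_add]
      exact mul_div_cancel_right₀ y huvp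
    rw [mem_ofPred_eq, hXw, hYw]
    exact ⟨⟨hx, hy⟩, hxy⟩

end Triangle

/-! ### Basic figures -/

lemma posArg_div_eq_zero {u v : ℂ} (hv : v ≠ 0) {x y : ℝ} (hx : 0 < x) (hy : 0 < y)
    (h : x • u = y • v) : posArg (u / v) = 0 := by
  have hdiv : u / v = ((y / x : ℝ) : ℂ) := by
    rw [div_eq_iff hv, ← Complex.real_smul, div_eq_inv_mul, mul_smul, ← h, inv_smul_smul₀ hx.ne']
  rw [hdiv, posArg, Complex.arg_ofReal_of_nonneg (by positivity), toIcoMod_apply_left]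

section FigureMap

variable {ℓ : ℕ} {z : ℕ → ℂ} {j : ℕ}

lemma figureMap_sub_figureMap (u v : ℂ) :
    figureMap ℓ z j u - figureMap ℓ z j v = (z j - z (j - 1)) / (z ℓ - z 0) * (u - v) := by
  rw [figureMap, figureMap]
  ring

lemma dist_figureMap (u v : ℂ) :
    dist (figureMap ℓ z j u) (figureMap ℓ z j v) =
      ‖(z j - z (j - 1)) / (z ℓ - z 0)‖ * dist u v := by
  rw [dist_eq_norm, dist_eq_norm, ← norm_mul, figureMap_sub_figureMap]

lemma continuous_figureMap : Continuous (figureMap ℓ z j) := by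
  unfold figureMap
  fun_prop

lemma figureMap_first : figureMap ℓ z j (z 0) = z (j - 1) := by
  rw [figureMap, sub_self, mul_zero, zero_add]

lemma figureMap_eq_of_sub_eq_smul (hℓ : z ℓ - z 0 ≠ 0) {t : ℝ}
    (ht : z j - z (j - 1) = t • (z ℓ - z 0)) (w : ℂ) :
    figureMap ℓ z j w = t • (w - z 0) + z (j - 1) := by
  rw [figureMap, ht, Complex.real_smul, mul_div_cancel_right₀ _ hℓ, Complex.real_smul]

end FigureMap

namespace IsBasicFigure

variable {ℓ q : ℕ} {z : ℕ → ℂ} {i j : ℕ} {w : ℂ} {x y : ℝ}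

lemma base_ne (h : IsBasicFigure ℓ q z) : z ℓ - z 0 ≠ 0 := by
  intro h0
  have := h.orientation
  simp [h0] at this

lemma one_le (h : IsBasicFigure ℓ q z) : 1 ≤ ℓ := by
  refine Nat.one_le_iff_ne_zero.2 ?_
  rintro rfl
  exact h.base_ne (sub_self _)

lemma areaForm_pos (h : IsBasicFigure ℓ q z) : 0 < ω (z ℓ - z 0) (z q - z 0) := by
  have hmul := areaForm_mul_mul (z ℓ - z 0) 1 ((z q - z 0) / (z ℓ - z 0))
  rw [mul_one, mul_div_cancel₀ _ h.base_ne] at hmul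
  rw [hmul, Complex.areaForm, map_one, one_mul]
  exact mul_pos (pow_pos (norm_pos_iff.2 h.base_ne) 2) h.orientation

lemma apex_notMem_segment (h : IsBasicFigure ℓ q z) : z q ∉ segment ℝ (z 0) (z ℓ) := by
  rw [segment_eq_image']
  rintro ⟨t, -, ht⟩
  have := h.areaForm_pos
  rw [← ht, add_sub_cancel_left, map_smul, Complex.orientation.areaForm_apply_self,
    smul_zero] at this
  exact this.false

lemma add_smul_mem_openTriangle (h : IsBasicFigure ℓ q z) (hx : 0 < x) (hy : 0 < y)
    (hxy : x + y < 1) : z 0 + (x • (z ℓ - z 0) + y • (z q - z 0)) ∈ openTriangle ℓ q z :=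
  add_smul_mem_interior_convexHull h.areaForm_pos.ne' hx hy hxy

lemma closedTriangle_eq (h : IsBasicFigure ℓ q z) :
    closedTriangle ℓ q z = convexHull ℝ {z 0, z ℓ, z q} := by
  have hne : (interior (convexHull ℝ {z 0, z ℓ, z q})).Nonempty :=
    ⟨_, h.add_smul_mem_openTriangle (x := 1 / 3) (y := 1 / 3) (by norm_num) (by norm_num)
      (by norm_num)⟩
  rw [closedTriangle, openTriangle,
    (convex_convexHull ℝ _).closure_interior_eq_closure_of_nonempty_interior hne]
  exact (toFinite _).isCompact_convexHull ℝ |>.isClosed.closure_eq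

lemma mem_closedTriangle_iff (h : IsBasicFigure ℓ q z) :
    w ∈ closedTriangle ℓ q z ↔ ∃ x y : ℝ, 0 ≤ x ∧ 0 ≤ y ∧ x + y ≤ 1 ∧
      z 0 + (x • (z ℓ - z 0) + y • (z q - z 0)) = w := by
  rw [h.closedTriangle_eq, mem_convexHull_triple]

lemma vertex_mem_closedTriangle (h : IsBasicFigure ℓ q z) (hj : j ≤ ℓ) :
    z j ∈ closedTriangle ℓ q z := by
  rcases h.vertex_mem j hj with (hapex | hbase) | hinterior
  · rw [h.closedTriangle_eq, hapex]
    exact subset_convexHull ℝ _ (by simp)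
  · rw [h.closedTriangle_eq]
    exact segment_subset_convexHull (by simp) (by simp) hbase
  · exact subset_closure hinterior

lemma figureMap_last (h : IsBasicFigure ℓ q z) : figureMap ℓ z j (z ℓ) = z j := by
  rw [figureMap, div_mul_cancel₀ _ h.base_ne, sub_add_cancel]

lemma figureMap_add_smul (h : IsBasicFigure ℓ q z) (x y : ℝ) :
    figureMap ℓ z j (z 0 + (x • (z ℓ - z 0) + y • (z q - z 0))) =
      z (j - 1) + (x • (z j - z (j - 1)) + y • (figureMap ℓ z j (z q) - z (j - 1))) := by
  rw [← sub_eq_iff_eq_add', ← figureMap_first (ℓ := ℓ) (z := z) (j := j),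
    ← h.figureMap_last (j := j), figureMap_sub_figureMap, figureMap_sub_figureMap,
    figureMap_sub_figureMap]
  simp only [Complex.real_smul]
  ring

lemma figureMap_mem_closedTriangle (h : IsBasicFigure ℓ q z) (hj : 1 ≤ j) (hj' : j ≤ ℓ)
    (hw : w ∈ closedTriangle ℓ q z) : figureMap ℓ z j w ∈ closedTriangle ℓ q z := by
  obtain ⟨x, y, hx, hy, hxy, rfl⟩ := h.mem_closedTriangle_iff.1 hw
  have hconvex : Convex ℝ (closedTriangle ℓ q z) := by
    rw [h.closedTriangle_eq]
    exact convex_convexHull ℝ _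
  have hvertices : {z (j - 1), z j, figureMap ℓ z j (z q)} ⊆ closedTriangle ℓ q z := by
    rintro v (rfl | rfl | rfl)
    exacts [h.vertex_mem_closedTriangle ((j.sub_le 1).trans hj'),
      h.vertex_mem_closedTriangle hj', h.apex_mem j hj hj']
  refine convexHull_min hvertices hconvex (mem_convexHull_triple.2 ⟨x, y, hx, hy, hxy, ?_⟩)
  rw [h.figureMap_add_smul]

lemma isOpenMap_figureMap (h : IsBasicFigure ℓ q z) (hj : 1 ≤ j) (hj' : j ≤ ℓ) :
    IsOpenMap (figureMap ℓ z j) :=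
  ((Homeomorph.subRight (z 0)).trans ((Homeomorph.mulLeft₀ _
    (norm_pos_iff.1 (h.contractive j hj hj').1)).trans
    (Homeomorph.addRight (z (j - 1))))).isOpenMap

lemma isOpen_image_openTriangle (h : IsBasicFigure ℓ q z) (hj : 1 ≤ j) (hj' : j ≤ ℓ) :
    IsOpen (figureMap ℓ z j '' openTriangle ℓ q z) :=
  h.isOpenMap_figureMap hj hj' _ isOpen_interior

lemma figureMap_mem_openTriangle (h : IsBasicFigure ℓ q z) (hj : 1 ≤ j) (hj' : j ≤ ℓ)
    (hw : w ∈ openTriangle ℓ q z) : figureMap ℓ z j w ∈ openTriangle ℓ q z := by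
  refine interior_maximal ?_ (h.isOpen_image_openTriangle hj hj') (mem_image_of_mem _ hw)
  rw [← h.closedTriangle_eq]
  exact image_subset_iff.2 fun v hv =>
    h.figureMap_mem_closedTriangle hj hj' (subset_closure hv)

lemma disjoint_image_openTriangle_image_closedTriangle (h : IsBasicFigure ℓ q z) (hi : 1 ≤ i)
    (hi' : i ≤ ℓ) (hj : 1 ≤ j) (hj' : j ≤ ℓ) (hij : i ≠ j) :
    Disjoint (figureMap ℓ z i '' openTriangle ℓ q z)
      (figureMap ℓ z j '' closedTriangle ℓ q z) :=
  ((h.disjoint i j hi hi' hj hj' hij).closure_right (h.isOpen_image_openTriangle hi hi')).mono_right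
    (image_closure_subset_closure_image continuous_figureMap)

-- The polygon is longer than its base because it passes through the apex.
lemma one_lt_sum_ratio (h : IsBasicFigure ℓ q z) :
    1 < ∑ j ∈ Finset.range ℓ, ‖(z (j + 1) - z j) / (z ℓ - z 0)‖ := by
  have hlength : dist (z 0) (z q) + dist (z q) (z ℓ) ≤
      ∑ j ∈ Finset.range ℓ, dist (z j) (z (j + 1)) := by
    rw [Finset.range_eq_Ico, ← Finset.sum_Ico_consecutive _ (Nat.zero_le q) h.q_le]
    exact add_le_add (dist_le_Ico_sum_dist z (Nat.zero_le q)) (dist_le_Ico_sum_dist z h.q_le)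
  have hstrict : dist (z 0) (z ℓ) < dist (z 0) (z q) + dist (z q) (z ℓ) :=
    (dist_triangle _ _ _).lt_of_ne fun he =>
      h.apex_notMem_segment (mem_segment_iff_wbtw.2 (dist_add_dist_eq_iff.1 he.symm))
  simp only [norm_div, ← Finset.sum_div, ← dist_eq_norm]
  rw [one_lt_div (dist_pos.2 (sub_ne_zero.1 h.base_ne)), dist_comm]
  simp only [dist_comm (z (_ + 1))]
  exact hstrict.trans_le hlength

lemma exists_figureMap_first_eq (h : IsBasicFigure ℓ q z) :
    ∃ t : ℝ, 0 < t ∧ t < 1 ∧ ∀ w, figureMap ℓ z 1 w = z 0 + t • (w - z 0) := by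
  have hmem := h.first_mem
  rw [segment_eq_image'] at hmem
  obtain ⟨t, ⟨ht, -⟩, he⟩ := hmem
  have hsub : z 1 - z (1 - 1) = t • (z ℓ - z 0) := by rw [Nat.sub_self, ← he, add_sub_cancel_left]
  have hratio := h.contractive 1 le_rfl h.one_le
  rw [hsub, Complex.real_smul, mul_div_cancel_right₀ _ h.base_ne, Complex.norm_real,
    Real.norm_of_nonneg ht] at hratio
  exact ⟨t, hratio.1, hratio.2, fun w => by
    rw [figureMap_eq_of_sub_eq_smul h.base_ne hsub, Nat.sub_self, add_comm]⟩

lemma exists_figureMap_last_eq (h : IsBasicFigure ℓ q z) :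
    ∃ t : ℝ, 0 < t ∧ t < 1 ∧ ∀ w, figureMap ℓ z ℓ w = z ℓ + t • (w - z ℓ) := by
  have hmem := h.last_mem
  rw [segment_symm, segment_eq_image'] at hmem
  obtain ⟨t, ⟨ht, -⟩, he⟩ := hmem
  have hsub : z ℓ - z (ℓ - 1) = t • (z ℓ - z 0) := by
    rw [← he]
    module
  have hratio := h.contractive ℓ h.one_le le_rfl
  rw [hsub, Complex.real_smul, mul_div_cancel_right₀ _ h.base_ne, Complex.norm_real,
    Real.norm_of_nonneg ht] at hratio
  refine ⟨t, hratio.1, hratio.2, fun w => ?_⟩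
  rw [figureMap_eq_of_sub_eq_smul h.base_ne hsub, ← he]
  module

lemma figureMap_first_or_last_mem_openTriangle (h : IsBasicFigure ℓ q z)
    (hw : w ∈ closedTriangle ℓ q z) (hbase : w ∉ segment ℝ (z 0) (z ℓ)) (hapex : w ≠ z q) :
    figureMap ℓ z 1 w ∈ openTriangle ℓ q z ∨ figureMap ℓ z ℓ w ∈ openTriangle ℓ q z := by
  obtain ⟨x, y, hx, hy, hxy, rfl⟩ := h.mem_closedTriangle_iff.1 hw
  have hy_pos : 0 < y := by
    refine hy.lt_of_ne' ?_
    rintro rfl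
    rw [segment_eq_image'] at hbase
    exact hbase ⟨x, ⟨hx, by linarith⟩, by simp only [zero_smul, add_zero]⟩
  rcases hx.eq_or_lt with rfl | hx_pos
  · right
    have hy_lt : y < 1 := by
      refine (zero_add y ▸ hxy).lt_of_ne ?_
      rintro rfl
      exact hapex (by module)
    obtain ⟨t, ht, ht', hmap⟩ := h.exists_figureMap_last_eq
    rw [hmap]
    convert h.add_smul_mem_openTriangle (x := 1 - t) (y := t * y) (by linarith)
      (mul_pos ht hy_pos) (by nlinarith) using 1
    module
  · left
    obtain ⟨t, ht, ht', hmap⟩ := h.exists_figureMap_first_eq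
    rw [hmap]
    convert h.add_smul_mem_openTriangle (mul_pos ht hx_pos) (mul_pos ht hy_pos) (by nlinarith)
      using 1
    module

lemma add_smul_mem_image_openTriangle (h : IsBasicFigure ℓ q z) (hx : 0 < x) (hy : 0 < y)
    (hxy : x + y < 1) :
    z (j - 1) + (x • (z j - z (j - 1)) + y • (figureMap ℓ z j (z q) - z (j - 1))) ∈
      figureMap ℓ z j '' openTriangle ℓ q z :=
  ⟨_, h.add_smul_mem_openTriangle hx hy hxy, h.figureMap_add_smul x y⟩

lemma add_smul_mem_image_openTriangle' (h : IsBasicFigure ℓ q z) (hx : 0 < x) (hy : 0 < y)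
    (hxy : x + y < 1) :
    z j + (x • (z (j - 1) - z j) + y • (figureMap ℓ z j (z q) - z j)) ∈
      figureMap ℓ z j '' openTriangle ℓ q z := by
  convert h.add_smul_mem_image_openTriangle (j := j) (x := 1 - x - y) (by linarith) hy
    (by linarith) using 1
  module

lemma exists_figureMap_sub_eq (h : IsBasicFigure ℓ q z) (hw : w ∈ closedTriangle ℓ q z) :
    ∃ x y : ℝ, 0 ≤ x ∧ 0 ≤ y ∧ figureMap ℓ z j w - z (j - 1) =
      x • (z j - z (j - 1)) + y • (figureMap ℓ z j (z q) - z (j - 1)) := by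
  obtain ⟨x, y, hx, hy, -, rfl⟩ := h.mem_closedTriangle_iff.1 hw
  exact ⟨x, y, hx, hy, by rw [h.figureMap_add_smul, add_sub_cancel_left]⟩

lemma exists_figureMap_sub_eq' (h : IsBasicFigure ℓ q z) (hw : w ∈ closedTriangle ℓ q z) :
    ∃ x y : ℝ, 0 ≤ x ∧ 0 ≤ y ∧ figureMap ℓ z j w - z j =
      x • (z (j - 1) - z j) + y • (figureMap ℓ z j (z q) - z j) := by
  obtain ⟨x, y, -, hy, hxy, rfl⟩ := h.mem_closedTriangle_iff.1 hw
  refine ⟨1 - x - y, y, by linarith, hy, ?_⟩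
  rw [h.figureMap_add_smul]
  module

lemma areaForm_image_pos (h : IsBasicFigure ℓ q z) (hj : 1 ≤ j) (hj' : j ≤ ℓ) :
    0 < ω (z j - z (j - 1)) (figureMap ℓ z j (z q) - z (j - 1)) := by
  have hbase := figureMap_sub_figureMap (ℓ := ℓ) (z := z) (j := j) (z ℓ) (z 0)
  have hapex := figureMap_sub_figureMap (ℓ := ℓ) (z := z) (j := j) (z q) (z 0)
  rw [figureMap_first] at hbase hapex
  rw [h.figureMap_last] at hbase
  have hmul := areaForm_mul_mul ((z j - z (j - 1)) / (z ℓ - z 0)) (z ℓ - z 0) (z q - z 0)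
  rw [← hapex, ← hbase] at hmul
  rw [hmul]
  exact mul_pos (pow_pos (h.contractive j hj hj').1 2) h.areaForm_pos

lemma areaForm_image_neg (h : IsBasicFigure ℓ q z) (hj : 1 ≤ j) (hj' : j ≤ ℓ) :
    ω (z (j - 1) - z j) (figureMap ℓ z j (z q) - z j) < 0 := by
  rw [← neg_sub (z j), ← sub_sub_sub_cancel_right _ (z j) (z (j - 1)), map_neg,
    LinearMap.neg_apply, map_sub, Complex.orientation.areaForm_apply_self, sub_zero]
  exact neg_neg_of_pos (h.areaForm_image_pos hj hj')

variable {x' y' : ℝ}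

lemma add_smul_ne_at_vertex (h : IsBasicFigure ℓ q z) (hi : 1 ≤ i) (hi' : i < ℓ) (hx : 0 < x)
    (hy : 0 < y) (hx' : 0 < x') (hy' : 0 < y') :
    x • (z (i - 1) - z i) + y • (figureMap ℓ z i (z q) - z i) ≠
      x' • (z (i + 1) - z i) + y' • (figureMap ℓ z (i + 1) (z q) - z i) := by
  intro he
  set ε := (x + y + x' + y')⁻¹
  have hε_pos : 0 < ε := by positivity
  have hε_mul : ε * (x + y + x' + y') = 1 := inv_mul_cancel₀ (by positivity)
  have hεx := mul_pos hε_pos hx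
  have hεy := mul_pos hε_pos hy
  have hεx' := mul_pos hε_pos hx'
  have hεy' := mul_pos hε_pos hy'
  have hleft := h.add_smul_mem_image_openTriangle' (j := i) hεx hεy (by linarith)
  have hright := h.add_smul_mem_image_openTriangle (j := i + 1) hεx' hεy' (by linarith)
  refine disjoint_left.1 (h.disjoint i (i + 1) hi hi'.le (by omega) hi' (by omega)) hleft ?_
  convert hright using 1
  rw [Nat.add_sub_cancel]
  linear_combination (norm := module) ε • he

lemma smul_sides_ne_at_vertex (h : IsBasicFigure ℓ q z) (hi : 1 ≤ i) (hi' : i < ℓ) (hx : 0 < x)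
    (hx' : 0 < x') : x • (z (i - 1) - z i) ≠ x' • (z (i + 1) - z i) := by
  intro he
  have hmem : z i + (x' / (x + x')) • (z (i + 1) - z i) ∈
      segment ℝ (z (i - 1)) (z i) ∩ segment ℝ (z i) (z (i + 1)) := by
    constructor
    · rw [segment_symm, segment_eq_image']
      refine ⟨x / (x + x'), ⟨by positivity, div_le_one_of_le₀ (by linarith) (by positivity)⟩, ?_⟩
      linear_combination (norm := module) (x + x')⁻¹ • he
    · rw [segment_eq_image']
      exact ⟨_, ⟨by positivity, div_le_one_of_le₀ (by linarith) (by positivity)⟩, rfl⟩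
  rw [h.polygon i hi hi', mem_singleton_iff, add_eq_left, smul_eq_zero, sub_eq_zero] at hmem
  have hratio := (h.contractive (i + 1) (by omega) hi').1
  rcases hmem with h0 | h0
  · exact (show 0 < x' / (x + x') by positivity).ne' h0
  · simp [h0] at hratio

lemma smul_apices_ne_at_vertex (hθ : 0 < cornerAngle ℓ q z i)
    (hne : figureMap ℓ z (i + 1) (z q) - z i ≠ 0) (hy : 0 < y) (hy' : 0 < y') :
    y • (figureMap ℓ z i (z q) - z i) ≠ y' • (figureMap ℓ z (i + 1) (z q) - z i) :=
  fun he => hθ.ne' (posArg_div_eq_zero hne hy hy' he)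

lemma exists_separation (h : IsBasicFigure ℓ q z) (hi : 1 ≤ i) (hi' : i < ℓ)
    (hθ : 0 < cornerAngle ℓ q z i) :
    ∃ K : ℝ, 0 ≤ K ∧ ∀ u ∈ closedTriangle ℓ q z, ∀ v ∈ closedTriangle ℓ q z,
      dist (figureMap ℓ z i u) (z i) ≤
        K * dist (figureMap ℓ z i u) (figureMap ℓ z (i + 1) v) := by
  have hleft := h.areaForm_image_neg hi hi'.le
  have hright := h.areaForm_image_pos (j := i + 1) (by omega) hi'
  rw [Nat.add_sub_cancel] at hright
  have hapex : figureMap ℓ z (i + 1) (z q) - z i ≠ 0 := fun h0 => by simp [h0] at hright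
  obtain ⟨K, hK_nonneg, hK⟩ := exists_norm_le_mul_norm_sub_of_cones fun x y x' y' =>
    eq_zero_of_disjoint_cones (mul_neg_of_neg_of_pos hleft hright)
      (fun _ _ _ _ => h.add_smul_ne_at_vertex hi hi')
      (fun _ _ => h.smul_sides_ne_at_vertex hi hi')
      (fun _ _ => smul_apices_ne_at_vertex hθ hapex)
  refine ⟨K, hK_nonneg, fun u hu v hv => ?_⟩
  obtain ⟨x, y, hx, hy, hxy⟩ := h.exists_figureMap_sub_eq' (j := i) hu
  obtain ⟨x', y', hx', hy', hxy'⟩ := h.exists_figureMap_sub_eq (j := i + 1) hv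
  rw [Nat.add_sub_cancel] at hxy'
  rw [dist_eq_norm, dist_eq_norm,
    ← sub_sub_sub_cancel_right (figureMap ℓ z i u) (figureMap ℓ z (i + 1) v) (z i), hxy, hxy']
  exact hK x y x' y' hx hy hx' hy'

end IsBasicFigure

/-! ### The arc -/

namespace IsRegularSelfSimilarArc

variable {ℓ q : ℕ} {z : ℕ → ℂ} {Λ : Set ℂ} {i j : ℕ} {w : ℂ}

lemma figureMap_mem (hΛ : IsRegularSelfSimilarArc ℓ q z Λ) (hj : 1 ≤ j) (hj' : j ≤ ℓ)
    (hw : w ∈ Λ) : figureMap ℓ z j w ∈ Λ := by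
  rw [hΛ.selfSimilar]
  exact mem_biUnion (show j ∈ Icc 1 ℓ from ⟨hj, hj'⟩) (mem_image_of_mem _ hw)

-- A point of `Λ` closest to a fixed point of `S_j` is moved closer by `S_j`.
lemma mem_of_figureMap_eq_self (hΛ : IsRegularSelfSimilarArc ℓ q z Λ) (hj : 1 ≤ j) (hj' : j ≤ ℓ)
    (hw : figureMap ℓ z j w = w) : w ∈ Λ := by
  obtain ⟨x, hx, hmin⟩ := hΛ.isCompact.exists_isMinOn hΛ.nonempty
    (f := fun x => dist x w) (by fun_prop)
  have hle : dist x w ≤ dist (figureMap ℓ z j x) (figureMap ℓ z j w) := by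
    rw [hw]
    exact hmin (hΛ.figureMap_mem hj hj' hx)
  rw [dist_figureMap] at hle
  have hratio := (hΛ.basicFigure.contractive j hj hj').2
  have hzero : dist x w = 0 := by nlinarith [dist_nonneg (x := x) (y := w)]
  rwa [← dist_eq_zero.1 hzero]

lemma first_mem (hΛ : IsRegularSelfSimilarArc ℓ q z Λ) : z 0 ∈ Λ :=
  hΛ.mem_of_figureMap_eq_self le_rfl hΛ.basicFigure.one_le figureMap_first

lemma last_mem (hΛ : IsRegularSelfSimilarArc ℓ q z Λ) : z ℓ ∈ Λ :=
  hΛ.mem_of_figureMap_eq_self hΛ.basicFigure.one_le le_rfl hΛ.basicFigure.figureMap_last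

lemma vertex_mem (hΛ : IsRegularSelfSimilarArc ℓ q z Λ) (hj : j ≤ ℓ) : z j ∈ Λ := by
  rcases Nat.eq_zero_or_pos j with rfl | hpos
  · exact hΛ.first_mem
  · rw [← hΛ.basicFigure.figureMap_last (j := j)]
    exact hΛ.figureMap_mem hpos hj hΛ.last_mem

lemma isSimilarityChain (hΛ : IsRegularSelfSimilarArc ℓ q z Λ) :
    IsSimilarityChain ℓ z (fun j => figureMap ℓ z (j + 1))
      (fun j => ‖(z (j + 1) - z j) / (z ℓ - z 0)‖) Λ where
  ratio_pos j hj := (hΛ.basicFigure.contractive (j + 1) (by omega) hj).1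
  ratio_lt_one j hj := (hΛ.basicFigure.contractive (j + 1) (by omega) hj).2
  dist_map _ _ u v := dist_figureMap u v
  map_first _ _ := figureMap_first
  map_last _ _ := hΛ.basicFigure.figureMap_last
  isCompact := hΛ.isCompact
  first_mem := hΛ.first_mem
  mapsTo _ hj _ hx := hΛ.figureMap_mem (by omega) hj hx
  exists_preimage x hx := by
    rw [hΛ.selfSimilar] at hx
    simp only [mem_iUnion, mem_Icc] at hx
    obtain ⟨j, ⟨hj, hj'⟩, y, hy, rfl⟩ := hx
    exact ⟨j - 1, by omega, y, hy, by rw [Nat.sub_add_cancel hj]⟩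

lemma subset_closedTriangle (hΛ : IsRegularSelfSimilarArc ℓ q z Λ) : Λ ⊆ closedTriangle ℓ q z := by
  have hdense := hΛ.isSimilarityChain.subset_closure (A := Λ ∩ closedTriangle ℓ q z)
    inter_subset_left
    ⟨z 0, hΛ.first_mem, hΛ.basicFigure.vertex_mem_closedTriangle (Nat.zero_le _)⟩
    (fun j hj x hx => ⟨hΛ.figureMap_mem (by omega) hj hx.1,
      hΛ.basicFigure.figureMap_mem_closedTriangle (by omega) hj hx.2⟩)
  exact hdense.trans (closure_minimal inter_subset_right isClosed_closure)

lemma isConnected (hΛ : IsRegularSelfSimilarArc ℓ q z Λ) : IsConnected Λ := by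
  obtain ⟨e⟩ := hΛ.isArc
  exact isConnected_iff_connectedSpace.2 (e.surjective.connectedSpace e.continuous)

lemma inter_openTriangle_nonempty (hΛ : IsRegularSelfSimilarArc ℓ q z Λ) :
    (Λ ∩ openTriangle ℓ q z).Nonempty := by
  have hB := hΛ.basicFigure
  by_contra hempty
  have hnot : ∀ w ∈ Λ, w ∉ openTriangle ℓ q z := fun w hw hw' => hempty ⟨w, hw, hw'⟩
  have hcover : Λ ⊆ segment ℝ (z 0) (z ℓ) ∪ {z q} := by
    intro w hw
    by_contra! hw'
    rw [mem_union, not_or, mem_singleton_iff] at hw'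
    rcases hB.figureMap_first_or_last_mem_openTriangle (hΛ.subset_closedTriangle hw) hw'.1 hw'.2
      with hfirst | hlast
    · exact hnot _ (hΛ.figureMap_mem le_rfl hB.one_le hw) hfirst
    · exact hnot _ (hΛ.figureMap_mem hB.one_le le_rfl hw) hlast
  have hclosed : IsClosed (segment ℝ (z 0) (z ℓ)) := by
    rw [← convexHull_pair]
    exact ((toFinite _).isCompact_convexHull ℝ).isClosed
  obtain ⟨w, -, hbase, rfl⟩ := isPreconnected_closed_iff.1 hΛ.isConnected.isPreconnected _ _
    hclosed isClosed_singleton hcover ⟨z 0, hΛ.first_mem, left_mem_segment ℝ _ _⟩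
    ⟨z q, hΛ.vertex_mem hB.q_le, rfl⟩
  exact hB.apex_notMem_segment hbase

lemma subset_closure_inter_openTriangle (hΛ : IsRegularSelfSimilarArc ℓ q z Λ) :
    Λ ⊆ closure (Λ ∩ openTriangle ℓ q z) :=
  hΛ.isSimilarityChain.subset_closure inter_subset_left hΛ.inter_openTriangle_nonempty
    (fun _ hj _ hx => ⟨hΛ.figureMap_mem (by omega) hj hx.1,
      hΛ.basicFigure.figureMap_mem_openTriangle (by omega) hj hx.2⟩)

lemma interior_inter_pieces_eq_empty (hΛ : IsRegularSelfSimilarArc ℓ q z Λ) (hi : 1 ≤ i)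
    (hi' : i ≤ ℓ) (hj : 1 ≤ j) (hj' : j ≤ ℓ) (hij : i ≠ j) :
    interior ((↑) ⁻¹' (figureMap ℓ z i '' Λ) ∩ (↑) ⁻¹' (figureMap ℓ z j '' Λ) : Set Λ) = ∅ := by
  refine eq_empty_of_forall_notMem fun x hx => ?_
  obtain ⟨_, hsub, hopen, hxO⟩ := mem_interior.1 hx
  obtain ⟨O, hO, rfl⟩ := isOpen_induced_iff.1 hopen
  obtain ⟨y, hy, hyx⟩ := (hsub hxO).1
  obtain ⟨v, hvO, hvΛ, hvT⟩ := mem_closure_iff.1 (hΛ.subset_closure_inter_openTriangle hy) _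
    (hO.preimage continuous_figureMap) (show figureMap ℓ z i y ∈ O from hyx ▸ hxO)
  have hmem := (@hsub ⟨figureMap ℓ z i v, hΛ.figureMap_mem hi hi' hvΛ⟩ hvO).2
  exact disjoint_left.1 (hΛ.basicFigure.disjoint_image_openTriangle_image_closedTriangle
    hi hi' hj hj' hij) (mem_image_of_mem _ hvT) (image_mono hΛ.subset_closedTriangle hmem)

lemma disjoint_pieces (hΛ : IsRegularSelfSimilarArc ℓ q z Λ) (hij : i + 1 < j) (hj : j < ℓ) :
    Disjoint (figureMap ℓ z (i + 1) '' Λ) (figureMap ℓ z (j + 1) '' Λ) := by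
  obtain ⟨e⟩ := hΛ.isArc
  have hB := hΛ.basicFigure
  let B : ℕ → Set Λ := fun k => (↑) ⁻¹' (figureMap ℓ z (k + 1) '' Λ)
  have hsub : ∀ k < ℓ, figureMap ℓ z (k + 1) '' Λ ⊆ Λ := fun k hk =>
    image_subset_iff.2 fun _ => hΛ.figureMap_mem (by omega) hk
  have himage : ∀ k < ℓ, (↑) '' B k = figureMap ℓ z (k + 1) '' Λ := fun k hk => by
    rw [Subtype.image_preimage_coe, inter_eq_right.2 (hsub k hk)]
  have hfirst : ∀ k (hk : k < ℓ), (⟨z k, hΛ.vertex_mem hk.le⟩ : Λ) ∈ B k := fun k hk =>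
    ⟨z 0, hΛ.first_mem, figureMap_first⟩
  have hlast : ∀ k (hk : k < ℓ), (⟨z (k + 1), hΛ.vertex_mem hk⟩ : Λ) ∈ B k := fun k hk =>
    ⟨z ℓ, hΛ.last_mem, hB.figureMap_last⟩
  have hdisj : Disjoint (B i) (B j) := by
    refine disjoint_of_chain_of_homeomorph e (n := ℓ) (fun k hk => ?_) (fun k hk => ?_)
      (fun k hk => ?_) (fun k hk m hm hkm => ?_) (fun k hk => ?_) hij hj
    · refine ⟨⟨_, hfirst k hk⟩, IsInducing.subtypeVal.isPreconnected_image.1 ?_⟩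
      rw [himage k hk]
      exact hΛ.isConnected.isPreconnected.image _ continuous_figureMap.continuousOn
    · rw [IsInducing.subtypeVal.isCompact_iff, himage k hk]
      exact hΛ.isCompact.image continuous_figureMap
    · refine ⟨_, hfirst k hk, _, hlast k hk, fun he => ?_⟩
      have hratio := (hB.contractive (k + 1) (by omega) hk).1
      have hvertex : z (k + 1) = z k := (congrArg Subtype.val he).symm
      simp [hvertex] at hratio
    · exact hΛ.interior_inter_pieces_eq_empty (by omega) hk (by omega) hm (by omega)
    · exact ⟨_, hlast k (by omega), hfirst (k + 1) hk⟩
  rw [← himage i (by omega), ← himage j hj]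
  exact (disjoint_image_iff Subtype.val_injective).2 hdisj

lemma exists_separation (hΛ : IsRegularSelfSimilarArc ℓ q z Λ) (hθ : 0 < minCornerAngle ℓ q z) :
    ∃ K : ℝ, 0 ≤ K ∧ ∀ i, i + 1 < ℓ → ∀ u ∈ Λ, ∀ v ∈ Λ,
      dist (figureMap ℓ z (i + 1) u) (z (i + 1)) ≤
        K * dist (figureMap ℓ z (i + 1) u) (figureMap ℓ z (i + 2) v) := by
  have hcorner : ∀ p, 1 ≤ p → p < ℓ → 0 < cornerAngle ℓ q z p := fun p hp hp' =>
    hθ.trans_le (csInf_le ((finite_Icc 1 (ℓ - 1)).image _).bddBelow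
      (mem_image_of_mem _ ⟨hp, by omega⟩))
  have hvertex : ∀ i : ℕ, ∃ K : ℝ, 0 ≤ K ∧ (i + 1 < ℓ → ∀ u ∈ Λ, ∀ v ∈ Λ,
      dist (figureMap ℓ z (i + 1) u) (z (i + 1)) ≤
        K * dist (figureMap ℓ z (i + 1) u) (figureMap ℓ z (i + 2) v)) := by
    intro i
    by_cases hi : i + 1 < ℓ
    · obtain ⟨K, hK_nonneg, hK⟩ := hΛ.basicFigure.exists_separation (by omega) hi
        (hcorner (i + 1) (by omega) hi)
      exact ⟨K, hK_nonneg, fun _ u hu v hv =>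
        hK u (hΛ.subset_closedTriangle hu) v (hΛ.subset_closedTriangle hv)⟩
    · exact ⟨0, le_rfl, fun h => absurd h hi⟩
  choose K hK_nonneg hK using hvertex
  refine ⟨∑ i ∈ Finset.range ℓ, K i, Finset.sum_nonneg fun i _ => hK_nonneg i,
    fun i hi u hu v hv => (hK i hi u hu v hv).trans ?_⟩
  gcongr
  exact Finset.single_le_sum (fun j _ => hK_nonneg j) (Finset.mem_range.2 (by omega))

lemma exists_isSnowflakeParametrization (hΛ : IsRegularSelfSimilarArc ℓ q z Λ)
    (hθ : 0 < minCornerAngle ℓ q z) :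
    ∃ (s c C : ℝ) (γ : ℝ → ℂ), IsSnowflakeParametrization s c C γ Λ ∧ γ 0 = z 0 := by
  obtain ⟨K, hK_nonneg, hK⟩ := hΛ.exists_separation hθ
  exact hΛ.isSimilarityChain.exists_isSnowflakeParametrization
    hΛ.basicFigure.one_lt_sum_ratio (sub_ne_zero.1 hΛ.basicFigure.base_ne).symm
    (fun _ _ => hΛ.disjoint_pieces) hK_nonneg hK

end IsRegularSelfSimilarArc

end

theorem theorem2 (ℓ q : ℕ) (z : ℕ → ℂ) (Λ : Set ℂ)
    (hΛ : IsRegularSelfSimilarArc ℓ q z Λ) (hθ : 0 < minCornerAngle ℓ q z)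
    (s : ℝ) (hs : s = (dimH Λ).toReal) :
    (∀ t : ℝ, 1 ≤ t → IsTQuasiArc t Λ) ∧
    IsQuasiArc Λ ∧
    -- the values of the Hausdorff measure function are finite
    Measure.hausdorffMeasure s Λ ≠ ⊤ ∧
    -- the function does not depend on the parametrization `h` of the arc
    ∀ h : unitInterval ≃ₜ Λ,
      IsStrictWhitneyFunctionOn Λ (hausdorffMeasureFunction h s (z 0)) := by
  obtain ⟨s', c, C, γ, hγ, h0⟩ := hΛ.exists_isSnowflakeParametrization hθ
  rw [hγ.toReal_dimH_eq] at hs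
  subst hs
  refine ⟨fun t ht => hγ.isTQuasiArc ht, hγ.isTQuasiArc le_rfl, hγ.hausdorffMeasure_ne_top,
    fun h => ?_⟩
  rw [← h0]
  exact hγ.isStrictWhitneyFunctionOn h
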